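/- For a measurable function $x\colon\mathbb R\to\mathbb R$ let $\|x\|=\operatorname{ess\,sup}_{t\in\mathbb R}|x(t)|$. For $r\in\mathbb N$, $r\ge 1$, let $L^r_{\infty,\infty}(\mathbb R)$ be the set of functions $x\colon\mathbb R\to\mathbb R$ such that $x^{(r-1)}$ exists and is locally absolutely continuous (where $x^{(0)}=x$), $\|x\|<\infty$ and $\|x^{(r)}\|<\infty$. For $a_1,a_2\ge 0$ put $T=a_1+a_2+2$. Let $\psi_1(a_1,a_2;\cdot)$ be the $2T$-periodic function with $\psi_1(t)=0$ on $[0,a_1]$, $\psi_1(t)=t-a_1$ on $[a_1,a_1+1]$, $\psi_1(t)=1$ on $[a_1+1,a_1+a_2+1]$, $\psi_1(t)=T-t$ on $[a_1+a_2+1,T]$ and $\psi_1(t)=-\psi_1(t-T)$ on $[T,2T]$. For $r\ge 2$ let $\psi_r(a_1,a_2;\cdot)$ be the $2T$-periodic function with zero mean over a period such that $\psi_r'(a_1,a_2;\cdot)=\psi_{r-1}(a_1,a_2;\cdot)$. For $\lambda>0$, $b\in\mathbb R$ put $$\Psi_{a_1,a_2,b,\lambda}(t)=\Psi_{r;a_1,a_2,b,\lambda}(t)=b\left(\frac{\lambda}{2a_1+2a_2+4}\right)^{r}\psi_r\!\left(a_1,a_2;\frac{2a_1+2a_2+4}{\lambda}\,t\right).$$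 **Theorem.** Let $r\in\mathbb N$, $r\ge 1$, and let $x\in L^r_{\infty,\infty}(\mathbb R)$ not be a nonzero constant function. Then a) there exist $a_2\ge 0$, $\lambda>0$ and $b\in\mathbb R$ such that $$\big\|\Psi_{0,a_2,b,\lambda}^{(s)}\big\|=\big\|x^{(s)}\big\|,\qquad s\in\{0,r-1,r\};$$ b) there exist $a_1\ge 0$, $\lambda>0$ and $b\in\mathbb R$ such that $$\big\|\Psi_{a_1,0,b,\lambda}^{(s)}\big\|=\big\|x^{(s)}\big\|,\qquad s\in\{0,r-2,r\};$$ c) there exist $a_1,a_2\ge 0$, $\lambda>0$ and $b\in\mathbb R$ such that $$\big\|\Psi_{a_1,a_2,b,\lambda}^{(s)}\big\|=\big\|x^{(s)}\big\|,\qquad s\in\{0,r-2,r-1,r\}.$$ If $r=1$, the condition for $s=r-2=-1$ in b) and c) is void and is omitted. -/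

import Mathlib

open MeasureTheory Set

noncomputable section

namespace RodovSpline

/-- The norm of `L_∞(ℝ)`: the essential supremum of `|f|`, with values in `[0, ∞]`. -/
def supNorm (f : ℝ → ℝ) : ENNReal := eLpNorm f ⊤ volume

/-- The class `L^r_{∞,∞}(ℝ)`, for `r ≥ 1`: the derivative of order `r - 1` exists and is locally
absolutely continuous, and both `x` and its (a.e. defined) derivative of order `r` are essentially
bounded. -/
structure MemLInfInf (r : ℕ) (x : ℝ → ℝ) : Prop where
  contDiff : ContDiff ℝ ((r - 1 : ℕ) : ℕ∞) x
  absolutelyContinuous : ∀ α β : ℝ, AbsolutelyContinuousOnInterval (iteratedDeriv (r - 1) x) α β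
  memLp_iteratedDeriv : MemLp (iteratedDeriv r x) ⊤ volume
  memLp : MemLp x ⊤ volume

/-- The half-period `T = a₁ + a₂ + 2`. -/
def halfPeriod (a₁ a₂ : ℝ) : ℝ := a₁ + a₂ + 2

/-- The values of `ψ₁(a₁, a₂; ·)` on `[0, T]`. -/
def trapezoid (a₁ a₂ t : ℝ) : ℝ :=
  if t ≤ a₁ then 0
  else if t ≤ a₁ + 1 then t - a₁
  else if t ≤ a₁ + a₂ + 1 then 1
  else 2 + a₁ + a₂ - t

/-- `ψ₁(a₁, a₂; ·)`: equal to `trapezoid` on `[0, T]`, continued to `[T, 2T]` by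
`ψ₁(t) = - ψ₁(t - T)`, and then with period `2T`; here `2T · fract (t / (2T))` is the
representative of `t` modulo `2T` in `[0, 2T)`. -/
def psiOne (a₁ a₂ t : ℝ) : ℝ :=
  let T := halfPeriod a₁ a₂
  let u := 2 * T * Int.fract (t / (2 * T))
  if u ≤ T then trapezoid a₁ a₂ u else - trapezoid a₁ a₂ (u - T)

/-- The antiderivative of `f` with mean value zero on `[0, P]`. It is `P`-periodic if `f` is
`P`-periodic with mean value zero. -/
def zeroMeanIntegral (P : ℝ) (f : ℝ → ℝ) (t : ℝ) : ℝ :=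
  (∫ u in (0 : ℝ)..t, f u) - (1 / P) * ∫ v in (0 : ℝ)..P, ∫ u in (0 : ℝ)..v, f u

/-- `ψ_r(a₁, a₂; ·)` for `r ≥ 1`: the `(r - 1)`-th `2T`-periodic integral of `ψ₁(a₁, a₂; ·)` with
zero mean on the period. The value at `r = 0` is never used. -/
def psi (a₁ a₂ : ℝ) : ℕ → ℝ → ℝ
  | 0 => fun _ => 0
  | 1 => psiOne a₁ a₂
  | n + 2 => zeroMeanIntegral (2 * halfPeriod a₁ a₂) (psi a₁ a₂ (n + 1))

/-- `Ψ_{r; a₁, a₂, b, λ}(t) = b (λ / (2a₁+2a₂+4))^r ψ_r(a₁, a₂; (2a₁+2a₂+4) t / λ)`. -/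
def Psi (r : ℕ) (a₁ a₂ b lam : ℝ) (t : ℝ) : ℝ :=
  b * (lam / (2 * a₁ + 2 * a₂ + 4)) ^ r * psi a₁ a₂ r ((2 * a₁ + 2 * a₂ + 4) / lam * t)

end RodovSpline

end

/-!
The norms of `Ψ` and its derivatives of orders `r`, `r - 1`, `r - 2` and `0` are, with
`μ = λ / (2T)`, equal to `|b|`, `|b| μ`, `|b| μ² (1 + a₂) / 2` and `|b| μ ^ r ‖ψ_r‖`. Matching the
highest derivatives of `x` therefore fixes `b`, then `μ` and, where required, `a₂`; unless `r` is so
small that nothing is left to match, the remaining parameter has to be chosen so that the norm of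
`x` itself is matched. The norm `‖ψ_r‖` depends continuously on the parameters
(`continuous_supAbs_psi`) and grows beyond all bounds with the free one
(`exists_le_supAbs_psi_right`, `exists_le_supAbs_psi_left`), so the intermediate value theorem
applies as soon as `‖x‖` is at least the norm of `Ψ` for the value `0` of the free parameter. This
is a Landau–Kolmogorov type inequality, extremal for `ψ_r(0, a₂; ·)`.

That inequality (`IsWaveTower.le_supAbs_of_le`) comes from a comparison theorem
(`IsWaveTower.comparison`), proved by induction on the order. Write `Φ' = φ` up to a translation
for two consecutive functions `ψ_k(0, a; ·)`, each even about its maximum, antiperiodic, and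
monotone between its maximum and its minimum. If `x'` does not descend faster than `φ`, and
`‖x‖ ≤ ‖Φ‖`, then `x` does not descend faster than `Φ`: where `x` takes a value of `Φ` with a
slope larger in modulus, the area under `|x'|` until `φ` vanishes would exceed the area under `|φ|`,
and `x` would leave the interval `[-‖Φ‖, ‖Φ‖]`. Likewise, if `‖x'‖ ≥ ‖φ‖` and `φ` has no plateau,
then `x'`, scaled down to the height of `φ`, contains nearly a full half-wave of `φ`, so that
`‖x‖ ≥ ‖Φ‖` (`IsWaveTower.supAbs_mul_le`).

Instead of iterated derivatives, the comparison uses towers of successive antiderivatives, indexed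
from the derivative of order `r - 1` (index `0`) down to the function itself (index `r - 1`).
-/

noncomputable section

namespace RodovSpline

/-! ### Waves and the comparison property -/

/-- A wave with quarter period `h`: a continuous function, antiperiodic with antiperiod `2h`, even,
and positive on its half-wave `(-h, h)`. -/
structure IsWave (h : ℝ) (φ : ℝ → ℝ) : Prop where
  quarter_pos : 0 < h
  continuous : Continuous φ
  antiperiodic : Function.Antiperiodic φ (2 * h)
  even : Function.Even φ
  pos : ∀ t, |t| < h → 0 < φ t

/-- `y` dominates `φ` on the quarter `[0, h]`: if at some point the value of `y` exceeds a value
taken by `φ` on `[0, h]`, then, to the right of that point, `y` stays above the corresponding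
translate of `φ` until the latter reaches `φ h`. For a decreasing `φ` this says that `y` does not
descend faster than `φ`. -/
def Dominates (h : ℝ) (y φ : ℝ → ℝ) : Prop :=
  ∀ ξ ζ t, 0 ≤ ζ → φ ζ < y ξ → 0 ≤ t → ζ + t ≤ h → φ (ζ + t) ≤ y (ξ + t)

/-- The functions `u 0, u 1, …, u n` are successive antiderivatives of `u 0`. -/
def IsTower (n : ℕ) (u : ℕ → ℝ → ℝ) : Prop :=
  ∀ k < n, ∀ t, HasDerivAt (u (k + 1)) (u k t) t

theorem IsTower.mono {m n : ℕ} {u : ℕ → ℝ → ℝ} (hu : IsTower n u) (hmn : m ≤ n) : IsTower m u :=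
  fun k hk => hu k (hk.trans_le hmn)

theorem IsTower.neg {n : ℕ} {u : ℕ → ℝ → ℝ} (hu : IsTower n u) :
    IsTower n (fun k t => -u k t) :=
  fun k hk t => (hu k hk t).neg

theorem IsTower.const_mul {n : ℕ} {u : ℕ → ℝ → ℝ} (hu : IsTower n u) (c : ℝ) :
    IsTower n (fun k t => c * u k t) :=
  fun k hk t => (hu k hk t).const_mul c

theorem IsTower.reflect {n : ℕ} {u : ℕ → ℝ → ℝ} (hu : IsTower n u) :
    IsTower n (fun k t => (-1) ^ k * u k (-t)) := by
  intro k hk t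
  have h := ((hu k hk (-t)).comp t (hasDerivAt_neg t)).const_mul ((-1 : ℝ) ^ (k + 1))
  refine h.congr_deriv ?_
  ring

theorem IsTower.continuous {n : ℕ} {u : ℕ → ℝ → ℝ} (hu : IsTower n u) (h0 : Continuous (u 0))
    {k : ℕ} (hk : k ≤ n) : Continuous (u k) := by
  cases k with
  | zero => exact h0
  | succ k => exact continuous_iff_continuousAt.2 fun t => (hu k hk t).continuousAt

/-- If `f' ≤ g'` on `[a, b]` then the increment of `f` over `[a, b]` is at most that of `g`. -/
theorem sub_le_sub_of_hasDerivAt_le {f g f' g' : ℝ → ℝ} {a b : ℝ} (hab : a ≤ b)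
    (hf : ∀ t, HasDerivAt f (f' t) t) (hg : ∀ t, HasDerivAt g (g' t) t)
    (hle : ∀ t ∈ Icc a b, f' t ≤ g' t) : f b - f a ≤ g b - g a := by
  have hd : ∀ t, HasDerivAt (fun s => g s - f s) (g' t - f' t) t := fun t => (hg t).sub (hf t)
  have hm : MonotoneOn (fun s => g s - f s) (Icc a b) := by
    refine monotoneOn_of_deriv_nonneg (convex_Icc a b)
      (fun t _ => (hd t).continuousAt.continuousWithinAt)
      (fun t _ => (hd t).differentiableAt.differentiableWithinAt) fun t ht => ?_
    rw [interior_Icc] at ht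
    rw [(hd t).deriv]
    exact sub_nonneg.2 (hle t (Ioo_subset_Icc_self ht))
  have := hm (left_mem_Icc.2 hab) (right_mem_Icc.2 hab) hab
  simp only at this
  linarith

/-- If `f' ≤ g'` on `[a, b]`, with strict inequality at `a`, and `f'`, `g'` are continuous, then the
increment of `f` over `[a, b]` is less than that of `g`. -/
theorem sub_lt_sub_of_hasDerivAt_le {f g f' g' : ℝ → ℝ} {a b : ℝ} (hab : a < b)
    (hf : ∀ t, HasDerivAt f (f' t) t) (hg : ∀ t, HasDerivAt g (g' t) t)
    (hf' : Continuous f') (hg' : Continuous g')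
    (hle : ∀ t ∈ Icc a b, f' t ≤ g' t) (hlt : f' a < g' a) : f b - f a < g b - g a := by
  have h := intervalIntegral.integral_lt_integral_of_continuousOn_of_le_of_exists_lt hab
    hf'.continuousOn hg'.continuousOn (fun t ht => hle t (Ioc_subset_Icc_self ht))
    ⟨a, left_mem_Icc.2 hab.le, hlt⟩
  rwa [intervalIntegral.integral_eq_sub_of_hasDerivAt (fun t _ => hf t)
      (hf'.intervalIntegrable _ _),
    intervalIntegral.integral_eq_sub_of_hasDerivAt (fun t _ => hg t)
      (hg'.intervalIntegrable _ _)] at h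

section Step

variable {h : ℝ} {φ Φ : ℝ → ℝ}

theorem IsWave.shift_sub (hφ : IsWave h φ) (t : ℝ) : φ (t + h) = -φ (t - h) := by
  have := hφ.antiperiodic (t - h)
  rwa [show t - h + 2 * h = t + h by ring] at this

theorem IsWave.shift_neg (hφ : IsWave h φ) {t : ℝ} (h0 : 0 < t) (h1 : t < 2 * h) :
    φ (t + h) < 0 := by
  rw [hφ.shift_sub, neg_lt_zero]
  exact hφ.pos _ (abs_lt.2 ⟨by linarith, by linarith⟩)

theorem IsWave.apply_quarter (hφ : IsWave h φ) : φ h = 0 := by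
  have h1 := hφ.antiperiodic (-h)
  rw [show -h + 2 * h = h by ring, hφ.even h] at h1
  linarith

/-- The antiperiodic antiderivative of a wave strictly decreases from its centre `0` to `2h`. -/
theorem IsWave.strictAntiOn_primitive (hφ : IsWave h φ)
    (hΦ : ∀ t, HasDerivAt Φ (φ (t + h)) t) : StrictAntiOn Φ (Icc 0 (2 * h)) := by
  refine strictAntiOn_of_deriv_neg (convex_Icc _ _)
    (fun t _ => (hΦ t).continuousAt.continuousWithinAt) fun t ht => ?_
  rw [interior_Icc] at ht
  rw [(hΦ t).deriv]
  exact hφ.shift_neg ht.1 ht.2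

theorem IsWave.primitive (hφ : IsWave h φ) (hΦ : ∀ t, HasDerivAt Φ (φ (t + h)) t)
    (hanti : Function.Antiperiodic Φ (2 * h)) : IsWave h Φ := by
  have heven : Function.Even Φ := by
    have hd : ∀ t, HasDerivAt (fun s => Φ (-s) - Φ s) 0 t := by
      intro t
      have h1 := ((hΦ (-t)).comp t (hasDerivAt_neg t)).sub (hΦ t)
      refine h1.congr_deriv ?_
      rw [hφ.shift_sub t, ← hφ.even (t - h), show -(t - h) = -t + h by ring]
      ring
    intro t
    have h2 := is_const_of_deriv_eq_zero (fun t => (hd t).differentiableAt)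
      (fun t => (hd t).deriv) t 0
    simp only [neg_zero, sub_self] at h2
    linarith
  have hq : Φ h = 0 := by
    have h1 := hanti (-h)
    rw [show -h + 2 * h = h by ring, heven h] at h1
    linarith
  refine ⟨hφ.quarter_pos, continuous_iff_continuousAt.2 fun t => (hΦ t).continuousAt, hanti, heven,
    fun t ht => ?_⟩
  have h0 := hφ.quarter_pos
  have h1 : Φ h < Φ |t| :=
    hφ.strictAntiOn_primitive hΦ ⟨abs_nonneg t, by linarith⟩ ⟨h0.le, by linarith⟩ ht
  rw [hq] at h1
  rcases abs_choice t with h2 | h2 <;> rw [h2] at h1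
  · exact h1
  · rwa [heven t] at h1

/-- A wave that decreases on `[0, 2h]` attains the maximum of its modulus at `0`. -/
theorem IsWave.abs_le (hφ : IsWave h φ) (hmono : AntitoneOn φ (Icc 0 (2 * h))) (t : ℝ) :
    |φ t| ≤ φ 0 := by
  have h0 := hφ.quarter_pos
  have key : ∀ s ∈ Ico (0 : ℝ) (2 * h), |φ s| ≤ φ 0 := by
    intro s hs
    have h1 : φ s ≤ φ 0 := hmono ⟨le_rfl, by linarith⟩ ⟨hs.1, hs.2.le⟩ hs.1
    have h2 : φ (2 * h) ≤ φ s := hmono ⟨hs.1, hs.2.le⟩ ⟨by linarith, le_rfl⟩ hs.2.le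
    have h3 := hφ.antiperiodic 0
    rw [zero_add] at h3
    exact _root_.abs_le.2 ⟨by linarith, h1⟩
  have hp : Function.Periodic (fun s => |φ s|) (2 * h) := fun s => by
    simp only [hφ.antiperiodic s, abs_neg]
  obtain ⟨s, hs, hst⟩ := hp.exists_mem_Ico₀ (by linarith) t
  rw [show |φ t| = |φ s| from hst]
  exact key s hs

/-- Half of the pointwise derivative comparison: on the part of the descending branch of `Φ` where
`Φ ≤ 0`, a function `x` that takes the value `Φ η` does not descend faster than `Φ`; otherwise,
since `-x'` dominates the half-wave of `-Φ'`, it would fall below `-Φ 0` further on. -/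
theorem IsWave.neg_le_of_lower (hφ : IsWave h φ) (hΦ : ∀ t, HasDerivAt Φ (φ (t + h)) t)
    (hanti : Function.Antiperiodic Φ (2 * h)) {x y : ℝ → ℝ} (hx : ∀ t, HasDerivAt x (y t) t)
    (hy : Continuous y) (hbd : ∀ t, |x t| ≤ Φ 0) (hdom : Dominates h (fun t => -y t) φ)
    {ξ η : ℝ} (h1 : h ≤ η) (h2 : η < 2 * h) (heq : x ξ = Φ η) : φ (η + h) ≤ y ξ := by
  by_contra! hlt
  have hlt' : φ (η - h) < -y ξ := by
    rw [hφ.shift_sub] at hlt; linarith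
  have hshift : ∀ t, HasDerivAt (fun s => Φ (η + s)) (φ (η + t + h)) t := fun t =>
    (hΦ (η + t)).comp_const_add η t
  have hxs : ∀ t, HasDerivAt (fun s => x (ξ + s)) (y (ξ + t)) t := fun t =>
    (hx (ξ + t)).comp_const_add ξ t
  have := sub_lt_sub_of_hasDerivAt_le (a := 0) (b := 2 * h - η) (by linarith) hxs hshift
    (by fun_prop) (hφ.continuous.comp (by fun_prop)) (fun t ht => by
      have h3 := hdom ξ (η - h) t (by linarith) hlt' ht.1 (by linarith [ht.2])
      simp only at h3
      rw [hφ.shift_sub, show η + t - h = η - h + t by ring]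
      linarith) (by simpa using hlt)
  simp only [add_zero, show η + (2 * h - η) = 0 + 2 * h by ring, hanti 0, heq] at this
  have h4 := _root_.abs_le.1 (hbd (ξ + (2 * h - η)))
  linarith [h4.1]

/-- The pointwise derivative comparison: where `x` takes a value of the descending branch of `Φ`, it
does not descend faster than `Φ`. -/
theorem IsWave.le_of_eq (hφ : IsWave h φ) (hΦ : ∀ t, HasDerivAt Φ (φ (t + h)) t)
    (hanti : Function.Antiperiodic Φ (2 * h)) {x y : ℝ → ℝ} (hx : ∀ t, HasDerivAt x (y t) t)
    (hy : Continuous y) (hbd : ∀ t, |x t| ≤ Φ 0) (hdom : Dominates h (fun t => -y t) φ)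
    (hdom' : Dominates h (fun t => -y (-t)) φ)
    {ξ η : ℝ} (h1 : 0 < η) (h2 : η < 2 * h) (heq : x ξ = Φ η) : φ (η + h) ≤ y ξ := by
  rcases le_total h η with h3 | h3
  · exact hφ.neg_le_of_lower hΦ hanti hx hy hbd hdom h3 h2 heq
  -- The map `t ↦ -x (-t)` exchanges the two halves of the branch.
  · have hx' : ∀ t, HasDerivAt (fun s => -x (-s)) (y (-t)) t := fun t => by
      have := ((hx (-t)).comp t (hasDerivAt_neg t)).neg
      exact this.congr_deriv (by ring)
    have hW := hφ.primitive hΦ hanti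
    have h4 := hφ.neg_le_of_lower hΦ hanti hx' (hy.comp continuous_neg)
      (fun t => by rw [abs_neg]; exact hbd _) hdom' (ξ := -ξ) (η := 2 * h - η) (by linarith)
      (by linarith) (by
        have h5 := hanti (-η)
        rw [show -η + 2 * h = 2 * h - η by ring, hW.even η] at h5
        rw [neg_neg, heq, h5])
    rw [neg_neg] at h4
    have h6 : φ (2 * h - η + h) = φ (η + h) := by
      rw [hφ.shift_sub, hφ.shift_sub, ← hφ.even (η - h)]
      congr 2; ring
    rwa [h6] at h4

/-- The inductive step of the comparison: if `± x'` and their reflections dominate the wave `φ`, and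
`|x|` is bounded by the maximum of the antiderivative wave `Φ`, then `x` dominates `Φ`. -/
theorem IsWave.dominates_primitive (hφ : IsWave h φ) (hΦ : ∀ t, HasDerivAt Φ (φ (t + h)) t)
    (hanti : Function.Antiperiodic Φ (2 * h)) {x y : ℝ → ℝ} (hx : ∀ t, HasDerivAt x (y t) t)
    (hy : Continuous y) (hbd : ∀ t, |x t| ≤ Φ 0) (hdom : Dominates h (fun t => -y t) φ)
    (hdom' : Dominates h (fun t => -y (-t)) φ) : Dominates h x Φ := by
  intro ξ ζ t hζ hlt ht hζt
  have h0 := hφ.quarter_pos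
  have hζ0 : 0 < ζ := by
    refine hζ.lt_of_ne fun h => ?_
    rw [← h] at hlt
    linarith [(_root_.abs_le.1 (hbd ξ)).2]
  -- `Φ` is run through at a speed `κ > 1`, which makes the comparison of derivatives strict.
  have key : ∀ κ ∈ Ioo (1 : ℝ) 2, Φ (ζ + κ * t) ≤ x (ξ + t) := by
    intro κ hκ
    have hf : ∀ s, HasDerivAt (fun s => Φ (ζ + κ * s)) (κ * φ (ζ + κ * s + h)) s := fun s => by
      have h1 : HasDerivAt (fun s => ζ + κ * s) κ s := by
        simpa using ((hasDerivAt_id s).const_mul κ).const_add ζ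
      exact ((hΦ (ζ + κ * s)).comp s h1).congr_deriv (mul_comm _ _)
    have hB : ∀ s, HasDerivAt (fun s => x (ξ + s)) (y (ξ + s)) s := fun s =>
      (hx (ξ + s)).comp_const_add ξ s
    have := image_le_of_deriv_right_lt_deriv_boundary (a := 0) (b := t)
      (fun s _ => (hf s).continuousAt.continuousWithinAt) (fun s _ => (hf s).hasDerivWithinAt)
      (by simpa using hlt.le) hB (fun s hs heq => by
        have h1 : 0 < ζ + κ * s := by
          have := mul_nonneg (by linarith [hκ.1] : 0 ≤ κ) hs.1
          linarith
        have h2 : ζ + κ * s < 2 * h := by nlinarith [hκ.1, hκ.2, hs.1, hs.2]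
        have h3 := hφ.le_of_eq hΦ hanti hx hy hbd hdom hdom' h1 h2 heq.symm
        have h4 := hφ.shift_neg h1 h2
        nlinarith [hκ.1])
    exact this ⟨ht, le_rfl⟩
  have hlim : Filter.Tendsto (fun κ : ℝ => Φ (ζ + κ * t)) (nhdsWithin 1 (Ioi 1))
      (nhds (Φ (ζ + 1 * t))) := by
    have : Continuous fun κ : ℝ => Φ (ζ + κ * t) :=
      (continuous_iff_continuousAt.2 fun t => (hΦ t).continuousAt).comp (by fun_prop)
    exact (this.tendsto 1).mono_left nhdsWithin_le_nhds
  rw [one_mul] at hlim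
  refine le_of_tendsto hlim ?_
  filter_upwards [Ioo_mem_nhdsGT (by norm_num : (1 : ℝ) < 2)] with κ hκ using key κ hκ

/-- If `z = x'` and `t ↦ z (-t)` dominate `φ`, and `z` exceeds `φ ζ` somewhere, then every bound
of `|x|` is at least the integral of `φ` over `[ζ, h]`, which is written as an increment of `Φ`: the
increment of `x` is at least this integral on both sides of the point in question. -/
theorem primitive_sub_le_of_dominates (hΦ : ∀ t, HasDerivAt Φ (φ (t + h)) t)
    {x z : ℝ → ℝ} (hx : ∀ t, HasDerivAt x (z t) t) {B : ℝ} (hbd : ∀ t, |x t| ≤ B)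
    (hdom : Dominates h z φ) (hdom' : Dominates h (fun t => z (-t)) φ)
    {ξ ζ : ℝ} (h1 : 0 ≤ ζ) (h2 : ζ ≤ h) (hlt : φ ζ < z ξ) : Φ 0 - Φ (ζ - h) ≤ B := by
  have hΦs : ∀ t, HasDerivAt (fun s => Φ (ζ - h + s)) (φ (ζ + t)) t := fun t => by
    refine ((hΦ (ζ - h + t)).comp_const_add (ζ - h) t).congr_deriv ?_
    congr 1; ring
  have hx1 : ∀ t, HasDerivAt (fun s => x (ξ + s)) (z (ξ + t)) t := fun t =>
    (hx (ξ + t)).comp_const_add ξ t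
  have hx2 : ∀ t, HasDerivAt (fun s => -x (ξ - s)) (z (ξ - t)) t := fun t => by
    refine ((hx (ξ - t)).comp_const_sub ξ t).neg.congr_deriv ?_
    ring
  have e1 := sub_le_sub_of_hasDerivAt_le (a := 0) (b := h - ζ) (by linarith) hΦs hx1
    fun t ht => hdom ξ ζ t h1 hlt ht.1 (by linarith [ht.2])
  have e2 := sub_le_sub_of_hasDerivAt_le (a := 0) (b := h - ζ) (by linarith) hΦs hx2
    fun t ht => by
      have := hdom' (-ξ) ζ t h1 (by simpa using hlt) ht.1 (by linarith [ht.2])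
      simp only at this
      rwa [show -(-ξ + t) = ξ - t by ring] at this
  simp only [add_zero, sub_zero, show ζ - h + (h - ζ) = 0 by ring] at e1 e2
  have b1 := _root_.abs_le.1 (hbd (ξ + (h - ζ)))
  have b2 := _root_.abs_le.1 (hbd (ξ - (h - ζ)))
  linarith [b1.2, b2.1]

end Step

/-! ### Bounds for intermediate derivatives -/

theorem abs_sub_le_of_hasDerivAt {f f' : ℝ → ℝ} {C : ℝ} (hf : ∀ t, HasDerivAt f (f' t) t)
    (hC : ∀ t, |f' t| ≤ C) (s t : ℝ) : |f s - f t| ≤ C * |s - t| :=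
  convex_univ.norm_image_sub_le_of_norm_hasDerivWithin_le
    (fun t _ => (hf t).hasDerivWithinAt) (fun t _ => hC t) (mem_univ t) (mem_univ s)

/-- A crude form of the Landau–Kolmogorov inequality: if the `n`-th derivative `u 0` of `u n` is
`M`-Lipschitz and `u n` is bounded by `B`, then `u 0` is bounded by `2 ^ n * B + n * M`. The reason
is that the difference of order `n` with step `1` is a mean value of the `n`-th derivative. -/
theorem IsTower.abs_zero_le {n : ℕ} {M : ℝ} (hM : 0 ≤ M) {u : ℕ → ℝ → ℝ} {B : ℝ}
    (hu : IsTower n u) (hlip : ∀ s t, |u 0 s - u 0 t| ≤ M * |s - t|) (hB : ∀ t, |u n t| ≤ B)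
    (t : ℝ) : |u 0 t| ≤ 2 ^ n * B + n * M := by
  induction n generalizing u B t with
  | zero => simpa using hB t
  | succ n ih =>
    have hv : IsTower n (fun j t => u (j + 1) (t + 1) - u (j + 1) t) := fun k hk t =>
      ((hu (k + 1) (by omega) (t + 1)).comp_add_const t 1).sub (hu (k + 1) (by omega) t)
    have h1 := ih hv (abs_sub_le_of_hasDerivAt
        (fun t => ((hu 0 (by omega) (t + 1)).comp_add_const t 1).sub (hu 0 (by omega) t))
        fun t => by simpa using hlip (t + 1) t)
      (B := 2 * B) (fun t => by
        have := abs_sub (u (n + 1) (t + 1)) (u (n + 1) t)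
        linarith [hB t, hB (t + 1)]) t
    obtain ⟨c, hc, hc'⟩ := exists_hasDerivAt_eq_slope (u 1) (u 0) (lt_add_one t)
      (fun s _ => (hu 0 (by omega) s).continuousAt.continuousWithinAt)
      (fun s _ => hu 0 (by omega) s)
    rw [add_sub_cancel_left, div_one] at hc'
    simp only [zero_add] at h1
    rw [← hc'] at h1
    have h2 := hlip t c
    have h3 : |t - c| ≤ 1 := abs_le.2 ⟨by linarith [hc.2], by linarith [hc.1]⟩
    have h4 : |u 0 t| ≤ |u 0 t - u 0 c| + |u 0 c| := by
      simpa using abs_add_le (u 0 t - u 0 c) (u 0 c)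
    have h5 : M * |t - c| ≤ M := by nlinarith
    push_cast
    rw [pow_succ]
    nlinarith

/-- If the first and the last function of a tower are bounded, so are all the others. -/
theorem IsTower.exists_bound {n : ℕ} {u : ℕ → ℝ → ℝ} (hu : IsTower n u)
    (h0 : ∃ C, ∀ t, |u 0 t| ≤ C) (hn : ∃ B, ∀ t, |u n t| ≤ B) {k : ℕ} (hk : k ≤ n) :
    ∃ C, ∀ t, |u k t| ≤ C := by
  induction k generalizing u n with
  | zero => exact h0
  | succ k ih =>
    obtain ⟨n, rfl⟩ : ∃ m, n = m + 1 := ⟨n - 1, by omega⟩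
    obtain ⟨C, hC⟩ := h0
    obtain ⟨B, hB⟩ := hn
    have hv : IsTower n (fun j => u (j + 1)) := fun j hj => hu (j + 1) (by omega)
    have hC0 : 0 ≤ C := (abs_nonneg _).trans (hC 0)
    exact ih hv ⟨_, hv.abs_zero_le hC0 (abs_sub_le_of_hasDerivAt (hu 0 (by omega)) hC) hB⟩
      ⟨B, hB⟩ (by omega)

/-! ### The supremum of the modulus -/

/-- The supremum of `|f|`; it is used for bounded `f` only. -/
def supAbs (f : ℝ → ℝ) : ℝ := ⨆ t, |f t|

theorem le_supAbs {f : ℝ → ℝ} (hf : ∃ C, ∀ t, |f t| ≤ C) (t : ℝ) : |f t| ≤ supAbs f := by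
  obtain ⟨C, hC⟩ := hf
  exact le_ciSup (f := fun t => |f t|) ⟨C, by rintro _ ⟨s, rfl⟩; exact hC s⟩ t

theorem supAbs_le {f : ℝ → ℝ} {C : ℝ} (hC : ∀ t, |f t| ≤ C) : supAbs f ≤ C := ciSup_le hC

theorem supAbs_nonneg (f : ℝ → ℝ) : 0 ≤ supAbs f := Real.iSup_nonneg fun t => abs_nonneg (f t)

theorem supAbs_const_mul_comp (c : ℝ) {d : ℝ} (hd : d ≠ 0) (f : ℝ → ℝ) :
    supAbs (fun t => c * f (d * t)) = |c| * supAbs f := by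
  have h1 : ∀ t, |c * f (d * t)| = |c| * |f (d * t)| := fun t => abs_mul _ _
  simp only [supAbs, h1]
  rw [← Real.mul_iSup_of_nonneg (abs_nonneg c)]
  congr 1
  exact (mul_left_surjective₀ hd).iSup_comp (fun t => |f t|)

theorem ae_enorm_le_supNorm (f : ℝ → ℝ) : ∀ᵐ t, ‖f t‖ₑ ≤ supNorm f := by
  rw [supNorm, eLpNorm_exponent_top]
  exact enorm_ae_le_eLpNormEssSup f volume

theorem enorm_le_supNorm {f : ℝ → ℝ} (hf : Continuous f) (t : ℝ) : ‖f t‖ₑ ≤ supNorm f := by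
  have hcl : IsClosed {t | ‖f t‖ₑ ≤ supNorm f} := isClosed_le hf.enorm continuous_const
  have ht : t ∈ closure {t | ‖f t‖ₑ ≤ supNorm f} :=
    Measure.dense_of_ae (ae_enorm_le_supNorm f) t
  rwa [hcl.closure_eq] at ht

theorem supNorm_le_ofReal {f : ℝ → ℝ} {C : ℝ} (hC : ∀ t, |f t| ≤ C) :
    supNorm f ≤ ENNReal.ofReal C := by
  rw [supNorm, eLpNorm_exponent_top]
  exact eLpNormEssSup_le_of_ae_bound (.of_forall hC)

theorem abs_le_toReal_of_enorm_le {y : ℝ} {M : ENNReal} (hM : M ≠ ⊤) (h : ‖y‖ₑ ≤ M) :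
    |y| ≤ M.toReal := by
  simpa using ENNReal.toReal_mono hM h

/-- The norm of `L_∞` of a continuous function is its supremum norm. -/
theorem supNorm_eq_ofReal_supAbs {f : ℝ → ℝ} (hf : Continuous f) (hb : ∃ C, ∀ t, |f t| ≤ C) :
    supNorm f = ENNReal.ofReal (supAbs f) := by
  have hle := supNorm_le_ofReal (le_supAbs hb)
  have htop : supNorm f ≠ ⊤ := ne_top_of_le_ne_top ENNReal.ofReal_ne_top hle
  exact hle.antisymm (ENNReal.ofReal_le_of_le_toReal
    (supAbs_le fun t => abs_le_toReal_of_enorm_le htop (enorm_le_supNorm hf t)))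

/-! ### The comparison theorem for towers -/

/-- The functions `φ 0, φ 1, …` are waves of quarter period `h`, each being the antiderivative of
the preceding one translated by `h`, and `φ 0` is the trapezoidal wave of slope `1` and height
`1`. -/
structure IsWaveTower (h : ℝ) (φ : ℕ → ℝ → ℝ) : Prop where
  wave : ∀ k, IsWave h (φ k)
  hasDerivAt : ∀ k t, HasDerivAt (φ (k + 1)) (φ k (t + h)) t
  one_le : 1 ≤ h
  zero_eq : ∀ t ∈ Icc 0 h, φ 0 t = min 1 (h - t)

namespace IsWaveTower

variable {h : ℝ} {φ : ℕ → ℝ → ℝ}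

theorem zero_zero (hφ : IsWaveTower h φ) : φ 0 0 = 1 := by
  rw [hφ.zero_eq 0 ⟨le_rfl, by linarith [hφ.one_le]⟩, sub_zero, min_eq_left hφ.one_le]

theorem pos_zero (hφ : IsWaveTower h φ) (k : ℕ) : 0 < φ k 0 :=
  (hφ.wave k).pos 0 (by simpa using (hφ.wave k).quarter_pos)

theorem supAbs_succ (hφ : IsWaveTower h φ) (k : ℕ) : supAbs (φ (k + 1)) = φ (k + 1) 0 := by
  have h1 := (hφ.wave (k + 1)).abs_le
    ((hφ.wave k).strictAntiOn_primitive (hφ.hasDerivAt k)).antitoneOn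
  refine le_antisymm (supAbs_le h1) ?_
  have h2 := le_supAbs ⟨_, h1⟩ 0
  rwa [abs_of_pos (hφ.pos_zero _)] at h2

/-- From level `1` on the maximum of the waves at `0` is strict; this holds at level `0` too if the
trapezoids degenerate to triangles. -/
theorem lt_zero (hφ : IsWaveTower h φ) {k : ℕ} (hk : 1 ≤ k ∨ h = 1) {ζ : ℝ} (h0 : 0 < ζ)
    (h1 : ζ ≤ h) : φ k ζ < φ k 0 := by
  cases k with
  | succ k =>
    exact (hφ.wave k).strictAntiOn_primitive (hφ.hasDerivAt k) ⟨le_rfl, by linarith⟩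
      ⟨h0.le, by linarith⟩ h0
  | zero =>
    obtain hk | rfl := hk
    · omega
    · rw [hφ.zero_eq ζ ⟨h0.le, h1⟩, hφ.zero_zero]
      exact min_lt_of_right_lt (by linarith)

theorem dominates_zero (hφ : IsWaveTower h φ) {y : ℝ → ℝ}
    (hlip : ∀ s t, |y s - y t| ≤ |s - t|) (hone : ∀ t, |y t| ≤ 1) : Dominates h y (φ 0) := by
  intro ξ ζ t h1 h2 h3 h4
  rw [hφ.zero_eq _ ⟨h1, by linarith⟩] at h2
  rw [hφ.zero_eq _ ⟨by linarith, h4⟩]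
  have h5 := (abs_le.1 (hone ξ)).2
  have h6 : h - ζ < y ξ := by
    rcases min_lt_iff.1 h2 with h | h
    · linarith
    · exact h
  have h7 := hlip ξ (ξ + t)
  rw [show ξ - (ξ + t) = -t by ring, abs_neg, abs_of_nonneg h3] at h7
  have h8 := (abs_le.1 h7).2
  exact (min_le_right _ _).trans (by linarith)

/-- The comparison at level `k`, as a hypothesis on `u k` for every admissible tower `u`. -/
def Comparison (h : ℝ) (φ : ℕ → ℝ → ℝ) (k : ℕ) : Prop :=
  ∀ u : ℕ → ℝ → ℝ, IsTower k u → (∀ s t, |u 0 s - u 0 t| ≤ |s - t|) → (∀ t, |u 0 t| ≤ 1) →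
    (∀ t, |u k t| ≤ φ k 0) → Dominates h (u k) (φ k)

theorem Comparison.neg {k : ℕ} (hc : Comparison h φ k) {u : ℕ → ℝ → ℝ} (hu : IsTower k u)
    (hlip : ∀ s t, |u 0 s - u 0 t| ≤ |s - t|) (hone : ∀ t, |u 0 t| ≤ 1)
    (hk : ∀ t, |u k t| ≤ φ k 0) : Dominates h (fun t => -u k t) (φ k) :=
  hc _ hu.neg (fun s t => by rw [neg_sub_neg, abs_sub_comm]; exact hlip s t)
    (fun t => by rw [abs_neg]; exact hone t) (fun t => by rw [abs_neg]; exact hk t)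

theorem Comparison.reflect {k : ℕ} (hc : Comparison h φ k) {u : ℕ → ℝ → ℝ} (hu : IsTower k u)
    (hlip : ∀ s t, |u 0 s - u 0 t| ≤ |s - t|) (hone : ∀ t, |u 0 t| ≤ 1)
    (hk : ∀ t, |u k t| ≤ φ k 0) : Dominates h (fun t => u k (-t)) (φ k) := by
  have hlip' : ∀ s t, |(-1) ^ 0 * u 0 (-s) - (-1) ^ 0 * u 0 (-t)| ≤ |s - t| := fun s t => by
    have := hlip (-s) (-t)
    rw [show -s - -t = -(s - t) by ring, abs_neg] at this
    simpa using this
  have hone' : ∀ t, |(-1) ^ 0 * u 0 (-t)| ≤ 1 := fun t => by simpa using hone (-t)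
  have hk' : ∀ t, |(-1) ^ k * u k (-t)| ≤ φ k 0 := fun t => by simpa [abs_mul] using hk (-t)
  rcases neg_one_pow_eq_or ℝ k with h1 | h1
  · simpa [h1] using hc _ hu.reflect hlip' hone' hk'
  · simpa [h1] using hc.neg hu.reflect hlip' hone' hk'

/-- Given the comparison at level `k`: if the supremum `c` of `|u k|` is at least the height of
`φ k`, then the bound of `|u (k + 1)|` relative to the height of `φ (k + 1)` is at least the ratio
of `c` and the height of `φ k`. Indeed, scaled down to that height, `u k` contains nearly a full
half-wave of `φ k`, whose integral is twice the height of `φ (k + 1)`. -/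
theorem supAbs_mul_le (hφ : IsWaveTower h φ) {k : ℕ} (hc : Comparison h φ k) (hk : 1 ≤ k ∨ h = 1)
    {u : ℕ → ℝ → ℝ} (hu : IsTower (k + 1) u) (hlip : ∀ s t, |u 0 s - u 0 t| ≤ |s - t|)
    (hone : ∀ t, |u 0 t| ≤ 1) {B : ℝ} (hB : ∀ t, |u (k + 1) t| ≤ B)
    (hge : φ k 0 ≤ supAbs (u k)) : supAbs (u k) * φ (k + 1) 0 ≤ φ k 0 * B := by
  have hbk := hu.exists_bound ⟨1, hone⟩ ⟨B, hB⟩ (Nat.le_succ k)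
  have hp := hφ.pos_zero k
  set c := supAbs (u k) with hcdef
  have hc0 : 0 < c := hp.trans_le hge
  set θ := φ k 0 / c with hθ
  have hθ0 : 0 < θ := div_pos hp hc0
  have hθ1 : θ ≤ 1 := (div_le_one hc0).2 hge
  have hθc : θ * c = φ k 0 := div_mul_cancel₀ _ hc0.ne'
  -- The tower scaled by `±θ` is admissible, and its level `k` has the height of `φ k`.
  have hdom : ∀ σ : ℝ, |σ| = θ → Dominates h (fun t => σ * u k t) (φ k) ∧
      Dominates h (fun t => σ * u k (-t)) (φ k) := by
    intro σ hσ
    have h1 := (hu.mono (Nat.le_succ k)).const_mul σ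
    have h2 : ∀ s t, |σ * u 0 s - σ * u 0 t| ≤ |s - t| := fun s t => by
      rw [← mul_sub, abs_mul, hσ]
      exact (mul_le_of_le_one_left (abs_nonneg _) hθ1).trans (hlip s t)
    have h3 : ∀ t, |σ * u 0 t| ≤ 1 := fun t => by
      rw [abs_mul, hσ]
      exact (mul_le_of_le_one_left (abs_nonneg _) hθ1).trans (hone t)
    have h4 : ∀ t, |σ * u k t| ≤ φ k 0 := fun t => by
      rw [abs_mul, hσ, ← hθc]
      exact mul_le_mul_of_nonneg_left (le_supAbs hbk t) hθ0.le
    exact ⟨hc _ h1 h2 h3 h4, hc.reflect h1 h2 h3 h4⟩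
  have hBθ : ∀ σ : ℝ, |σ| = θ → ∀ t, |σ * u (k + 1) t| ≤ θ * B := fun σ hσ t => by
    rw [abs_mul, hσ]
    exact mul_le_mul_of_nonneg_left (hB t) hθ0.le
  have key : ∀ ζ ∈ Ioo 0 h, φ (k + 1) 0 - φ (k + 1) (ζ - h) ≤ θ * B := by
    intro ζ hζ
    have h1 : φ k ζ / θ < c := by
      rw [div_lt_iff₀ hθ0, mul_comm, hθc]
      exact hφ.lt_zero hk hζ.1 hζ.2.le
    obtain ⟨ξ, hξ⟩ := exists_lt_of_lt_ciSup h1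
    rw [div_lt_iff₀ hθ0] at hξ
    have hsgn : ∃ σ : ℝ, |σ| = θ ∧ σ * u k ξ = |u k ξ| * θ := by
      rcases abs_choice (u k ξ) with h2 | h2
      · exact ⟨θ, abs_of_pos hθ0, by rw [h2, mul_comm]⟩
      · exact ⟨-θ, by rw [abs_neg, abs_of_pos hθ0], by rw [h2]; ring⟩
    obtain ⟨σ, hσ, hσξ⟩ := hsgn
    exact primitive_sub_le_of_dominates (hφ.hasDerivAt k)
      (fun t => (hu k (Nat.lt_succ_self k) t).const_mul σ) (hBθ σ hσ) (hdom σ hσ).1 (hdom σ hσ).2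
      hζ.1.le hζ.2.le (ξ := ξ) (by simpa [hσξ] using hξ)
  have hlim : Filter.Tendsto (fun ζ : ℝ => φ (k + 1) 0 - φ (k + 1) (ζ - h)) (nhdsWithin 0 (Ioi 0))
      (nhds (φ (k + 1) 0 - φ (k + 1) (0 - h))) := by
    have : Continuous fun ζ : ℝ => φ (k + 1) 0 - φ (k + 1) (ζ - h) :=
      continuous_const.sub ((hφ.wave (k + 1)).continuous.comp (by fun_prop))
    exact (this.tendsto 0).mono_left nhdsWithin_le_nhds
  rw [zero_sub, (hφ.wave (k + 1)).even, (hφ.wave (k + 1)).apply_quarter, sub_zero] at hlim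
  have hfin : φ (k + 1) 0 ≤ θ * B := by
    refine le_of_tendsto hlim ?_
    filter_upwards [Ioo_mem_nhdsGT (hφ.wave k).quarter_pos] with ζ hζ using key ζ hζ
  calc c * φ (k + 1) 0 ≤ c * (θ * B) := mul_le_mul_of_nonneg_left hfin hc0.le
    _ = φ k 0 * B := by rw [← hθc]; ring

/-- The comparison theorem: a function whose `k`-th derivative is `1`-Lipschitz and bounded by `1`,
and whose modulus does not exceed the height of the wave `φ k`, dominates that wave. -/
theorem comparison (hφ : IsWaveTower h φ) (k : ℕ) : Comparison h φ k := by
  induction k with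
  | zero => exact fun u _ hlip hone _ => hφ.dominates_zero hlip hone
  | succ k ih =>
    intro u hu hlip hone hbd
    have hu' := hu.mono (Nat.le_succ k)
    have hk : ∀ t, |u k t| ≤ φ k 0 := by
      rcases Nat.eq_zero_or_pos k with rfl | hk
      · rw [hφ.zero_zero]; exact hone
      by_contra! hne
      obtain ⟨t, ht⟩ := hne
      have hc : φ k 0 < supAbs (u k) :=
        ht.trans_le (le_supAbs (hu.exists_bound ⟨1, hone⟩ ⟨_, hbd⟩ (Nat.le_succ k)) t)
      have := hφ.supAbs_mul_le ih (.inl hk) hu hlip hone hbd hc.le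
      exact absurd (le_of_mul_le_mul_right this (hφ.pos_zero _)) (not_le.2 hc)
    have h0 : Continuous (u 0) := by
      refine (LipschitzWith.of_dist_le_mul (K := 1) fun s t => ?_).continuous
      simpa [Real.dist_eq] using hlip s t
    have hn := hu'.neg
    have hn1 : ∀ s t, |-u 0 s - -u 0 t| ≤ |s - t| := fun s t => by
      rw [neg_sub_neg, abs_sub_comm]; exact hlip s t
    have hn2 : ∀ t, |-u 0 t| ≤ 1 := fun t => by rw [abs_neg]; exact hone t
    have hn3 : ∀ t, |-u k t| ≤ φ k 0 := fun t => by rw [abs_neg]; exact hk t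
    exact (hφ.wave k).dominates_primitive (hφ.hasDerivAt k) (hφ.wave (k + 1)).antiperiodic
      (hu k (Nat.lt_succ_self k)) (hu'.continuous h0 le_rfl) hbd (ih.neg hu' hlip hone hk)
      (ih.reflect hn hn1 hn2 hn3)

/-- If the derivative `u m` of `u n` is at least as large as the wave `φ m`, then `u n` is at least
as large as the wave `φ n`. -/
theorem le_supAbs_of_le (hφ : IsWaveTower h φ) {m n : ℕ} (hm : 1 ≤ m ∨ h = 1) (hmn : m ≤ n)
    {u : ℕ → ℝ → ℝ} (hu : IsTower n u) (hlip : ∀ s t, |u 0 s - u 0 t| ≤ |s - t|)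
    (hone : ∀ t, |u 0 t| ≤ 1) (hbd : ∃ B, ∀ t, |u n t| ≤ B) (hge : φ m 0 ≤ supAbs (u m)) :
    φ n 0 ≤ supAbs (u n) := by
  induction n, hmn using Nat.le_induction with
  | base => exact hge
  | succ k hk ih =>
    have h1 := ih (hu.mono (Nat.le_succ k))
      (hu.exists_bound ⟨1, hone⟩ hbd (Nat.le_succ k))
    have h2 := hφ.supAbs_mul_le (hφ.comparison k) (hm.imp_left (·.trans hk)) hu hlip hone
      (le_supAbs hbd) h1
    have h3 := hφ.pos_zero k
    have h4 := hφ.pos_zero (k + 1)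
    refine le_of_mul_le_mul_left ?_ h3
    exact (mul_le_mul_of_nonneg_right h1 h4.le).trans h2

end IsWaveTower

/-! ### The functions `ψ_r` -/

/-- If `f' = g'` on `[a, b]` then `f` and `g` have the same increment over `[a, b]`. -/
theorem sub_eq_sub_of_hasDerivAt_eq {f g f' g' : ℝ → ℝ} {a b : ℝ} (hab : a ≤ b)
    (hf : ∀ t, HasDerivAt f (f' t) t) (hg : ∀ t, HasDerivAt g (g' t) t)
    (heq : ∀ t ∈ Icc a b, f' t = g' t) : f b - f a = g b - g a :=
  le_antisymm (sub_le_sub_of_hasDerivAt_le hab hf hg fun t ht => (heq t ht).le)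
    (sub_le_sub_of_hasDerivAt_le hab hg hf fun t ht => (heq t ht).ge)

/-- The trapezoid on `[0, T]`, continued by zero to the real line. -/
def bump (a₁ a₂ t : ℝ) : ℝ := max 0 (min 1 (min (t - a₁) (halfPeriod a₁ a₂ - t)))

section PsiFunctions

variable {a₁ a₂ : ℝ}

theorem halfPeriod_pos (h₁ : 0 ≤ a₁) (h₂ : 0 ≤ a₂) : 0 < halfPeriod a₁ a₂ := by
  unfold halfPeriod; linarith

theorem bump_of_le {t : ℝ} (ht : t ≤ a₁) : bump a₁ a₂ t = 0 :=
  max_eq_left ((min_le_right _ _).trans ((min_le_left _ _).trans (by linarith)))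

theorem bump_of_ge {t : ℝ} (ht : halfPeriod a₁ a₂ ≤ t) : bump a₁ a₂ t = 0 :=
  max_eq_left ((min_le_right _ _).trans ((min_le_right _ _).trans (by linarith)))

theorem bump_nonneg (t : ℝ) : 0 ≤ bump a₁ a₂ t := le_max_left _ _

theorem bump_le_one (t : ℝ) : bump a₁ a₂ t ≤ 1 := max_le zero_le_one (min_le_left _ _)

theorem abs_bump_sub_le (s t : ℝ) : |bump a₁ a₂ s - bump a₁ a₂ t| ≤ |s - t| := by
  unfold bump
  refine (abs_max_sub_max_le_max _ _ _ _).trans (max_le (by simp) ?_)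
  refine (abs_min_sub_min_le_max _ _ _ _).trans (max_le (by simp) ?_)
  refine (abs_min_sub_min_le_max _ _ _ _).trans (max_le ?_ ?_)
  · rw [sub_sub_sub_cancel_right]
  · rw [sub_sub_sub_cancel_left, abs_sub_comm]

theorem trapezoid_eq_bump (h₂ : 0 ≤ a₂) {t : ℝ} (ht : t ≤ halfPeriod a₁ a₂) :
    trapezoid a₁ a₂ t = bump a₁ a₂ t := by
  unfold trapezoid bump
  unfold halfPeriod at ht ⊢
  split_ifs with c1 c2 c3
  · rw [max_eq_left]
    exact (min_le_right _ _).trans ((min_le_left _ _).trans (by linarith))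
  · rw [min_eq_left (b := a₁ + a₂ + 2 - t) (by linarith), min_eq_right (by linarith),
      max_eq_right (by linarith)]
  · rw [min_eq_left (le_min (by linarith) (by linarith)), max_eq_right zero_le_one]
  · rw [min_eq_right (a := t - a₁) (by linarith), min_eq_right (by linarith),
      max_eq_right (by linarith)]
    ring

theorem psiOne_eq_bump_fract (h₁ : 0 ≤ a₁) (h₂ : 0 ≤ a₂) (t : ℝ) :
    psiOne a₁ a₂ t =
      bump a₁ a₂ (2 * halfPeriod a₁ a₂ * Int.fract (t / (2 * halfPeriod a₁ a₂))) -
      bump a₁ a₂ (2 * halfPeriod a₁ a₂ * Int.fract (t / (2 * halfPeriod a₁ a₂)) -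
        halfPeriod a₁ a₂) := by
  have hT := halfPeriod_pos h₁ h₂
  have hf := Int.fract_lt_one (t / (2 * halfPeriod a₁ a₂))
  unfold psiOne
  dsimp only
  set T := halfPeriod a₁ a₂ with hTdef
  set u := 2 * T * Int.fract (t / (2 * T))
  have hu : u < 2 * T := mul_lt_of_lt_one_right (by linarith) hf
  split_ifs with hc
  · rw [trapezoid_eq_bump h₂ hc, bump_of_le (t := u - T) (by linarith), sub_zero]
  · rw [trapezoid_eq_bump h₂ (t := u - T) (by linarith), bump_of_ge (t := u) (by linarith),
      zero_sub]

theorem psiOne_eq_bump (h₁ : 0 ≤ a₁) (h₂ : 0 ≤ a₂) {t : ℝ}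
    (ht : t ∈ Ico 0 (2 * halfPeriod a₁ a₂)) :
    psiOne a₁ a₂ t = bump a₁ a₂ t - bump a₁ a₂ (t - halfPeriod a₁ a₂) := by
  have hT := halfPeriod_pos h₁ h₂
  rw [psiOne_eq_bump_fract h₁ h₂, Int.fract_eq_self.2 ⟨by have := ht.1; positivity,
    (div_lt_one (by linarith)).2 ht.2⟩, mul_div_cancel₀ _ (by linarith)]

theorem psiOne_periodic (h₁ : 0 ≤ a₁) (h₂ : 0 ≤ a₂) :
    Function.Periodic (psiOne a₁ a₂) (2 * halfPeriod a₁ a₂) := fun t => by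
  have hT := halfPeriod_pos h₁ h₂
  rw [psiOne_eq_bump_fract h₁ h₂, psiOne_eq_bump_fract h₁ h₂, add_div, div_self (by linarith),
    Int.fract_add_one]

theorem psiOne_antiperiodic (h₁ : 0 ≤ a₁) (h₂ : 0 ≤ a₂) :
    Function.Antiperiodic (psiOne a₁ a₂) (halfPeriod a₁ a₂) := by
  have hT := halfPeriod_pos h₁ h₂
  set T := halfPeriod a₁ a₂ with hTdef
  have hper := psiOne_periodic h₁ h₂
  rw [← hTdef] at hper
  have hp : Function.Periodic (fun t => psiOne a₁ a₂ (t + T) + psiOne a₁ a₂ t) (2 * T) :=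
    fun t => by
      simp only
      rw [hper t, show t + 2 * T + T = t + T + 2 * T by ring, hper]
  intro t
  obtain ⟨s, hs, hst⟩ := hp.exists_mem_Ico₀ (by linarith) t
  rw [eq_neg_iff_add_eq_zero,
    show psiOne a₁ a₂ (t + T) + psiOne a₁ a₂ t = psiOne a₁ a₂ (s + T) + psiOne a₁ a₂ s from hst,
    psiOne_eq_bump h₁ h₂ hs]
  rcases lt_or_ge s T with hc | hc
  · rw [psiOne_eq_bump h₁ h₂ ⟨by linarith [hs.1], by linarith⟩, add_sub_cancel_right,
      bump_of_ge (t := s + T) (by linarith [hs.1]), bump_of_le (t := s - T) (by linarith)]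
    ring
  · rw [show s + T = s - T + 2 * T by ring, hper, psiOne_eq_bump h₁ h₂
      ⟨by linarith, by linarith [hs.2]⟩, bump_of_ge (t := s) (by linarith),
      bump_of_le (t := s - T - T) (by linarith [hs.2])]
    ring

theorem psiOne_eq_bump_of_mem (h₁ : 0 ≤ a₁) (h₂ : 0 ≤ a₂) {t : ℝ}
    (ht : t ∈ Icc 0 (halfPeriod a₁ a₂)) : psiOne a₁ a₂ t = bump a₁ a₂ t := by
  have hT := halfPeriod_pos h₁ h₂
  rw [psiOne_eq_bump h₁ h₂ ⟨ht.1, by linarith [ht.2]⟩,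
    bump_of_le (t := t - halfPeriod a₁ a₂) (by linarith [ht.2]), sub_zero]

theorem abs_psiOne_le_one (h₁ : 0 ≤ a₁) (h₂ : 0 ≤ a₂) (t : ℝ) : |psiOne a₁ a₂ t| ≤ 1 := by
  rw [psiOne_eq_bump_fract h₁ h₂]
  refine abs_sub_le_iff.2 ⟨?_, ?_⟩ <;>
  linarith [bump_nonneg (a₁ := a₁) (a₂ := a₂)
      (2 * halfPeriod a₁ a₂ * Int.fract (t / (2 * halfPeriod a₁ a₂))),
    bump_le_one (a₁ := a₁) (a₂ := a₂)
      (2 * halfPeriod a₁ a₂ * Int.fract (t / (2 * halfPeriod a₁ a₂))),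
    bump_nonneg (a₁ := a₁) (a₂ := a₂)
      (2 * halfPeriod a₁ a₂ * Int.fract (t / (2 * halfPeriod a₁ a₂)) - halfPeriod a₁ a₂),
    bump_le_one (a₁ := a₁) (a₂ := a₂)
      (2 * halfPeriod a₁ a₂ * Int.fract (t / (2 * halfPeriod a₁ a₂)) - halfPeriod a₁ a₂)]

theorem supAbs_psiOne (h₁ : 0 ≤ a₁) (h₂ : 0 ≤ a₂) : supAbs (psiOne a₁ a₂) = 1 := by
  refine le_antisymm (supAbs_le (abs_psiOne_le_one h₁ h₂)) ?_
  have h := le_supAbs ⟨1, abs_psiOne_le_one h₁ h₂⟩ (a₁ + 1)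
  rw [psiOne_eq_bump_of_mem h₁ h₂ ⟨by linarith, by unfold halfPeriod; linarith⟩] at h
  have h1 : bump a₁ a₂ (a₁ + 1) = 1 := by
    unfold bump halfPeriod
    rw [min_eq_left (le_min (by linarith) (by linarith)), max_eq_right zero_le_one]
  rwa [h1, abs_one] at h

theorem abs_deriv_psiOne_le_one (h₁ : 0 ≤ a₁) (h₂ : 0 ≤ a₂) (t : ℝ) :
    |deriv (psiOne a₁ a₂) t| ≤ 1 := by
  have hT := halfPeriod_pos h₁ h₂
  have hp : Function.Periodic (fun t => |deriv (psiOne a₁ a₂) t|) (halfPeriod a₁ a₂) := fun t => by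
    simp only
    rw [← deriv_comp_add_const (psiOne a₁ a₂), funext (psiOne_antiperiodic h₁ h₂),
      deriv.fun_neg, abs_neg]
  obtain ⟨s, hs, hst⟩ := hp.exists_mem_Ico₀ hT t
  rw [show |deriv (psiOne a₁ a₂) t| = |deriv (psiOne a₁ a₂) s| from hst]
  refine norm_deriv_le_of_lip' (f := psiOne a₁ a₂) zero_le_one ?_
  rcases hs.1.eq_or_lt with rfl | hs0
  · filter_upwards [Ioo_mem_nhds (neg_lt_zero.2 hT) hT] with v hv
    rw [psiOne_eq_bump_of_mem h₁ h₂ ⟨le_rfl, hT.le⟩, bump_of_le (t := 0) h₁, sub_zero, sub_zero,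
      one_mul]
    rcases le_total 0 v with h | h
    · rw [psiOne_eq_bump_of_mem h₁ h₂ ⟨h, hv.2.le⟩]
      simpa [bump_of_le (a₂ := a₂) h₁] using abs_bump_sub_le (a₁ := a₁) (a₂ := a₂) v 0
    · have h3 := psiOne_antiperiodic h₁ h₂ v
      rw [psiOne_eq_bump_of_mem h₁ h₂ ⟨by linarith [hv.1], by linarith⟩] at h3
      have h4 := abs_bump_sub_le (a₁ := a₁) (a₂ := a₂) (v + halfPeriod a₁ a₂) (halfPeriod a₁ a₂)
      rw [h3, bump_of_ge le_rfl] at h4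
      simpa using h4
  · filter_upwards [Ioo_mem_nhds hs0 hs.2] with v hv
    rw [psiOne_eq_bump_of_mem h₁ h₂ ⟨hv.1.le, hv.2.le⟩,
      psiOne_eq_bump_of_mem h₁ h₂ ⟨hs.1, hs.2.le⟩, one_mul]
    exact abs_bump_sub_le v s

theorem deriv_psiOne_eq_one (h₁ : 0 ≤ a₁) (h₂ : 0 ≤ a₂) {t : ℝ} (ht : t ∈ Ioo a₁ (a₁ + 1)) :
    deriv (psiOne a₁ a₂) t = 1 := by
  have : psiOne a₁ a₂ =ᶠ[nhds t] fun s => s - a₁ := by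
    filter_upwards [Ioo_mem_nhds ht.1 ht.2] with s hs
    rw [psiOne_eq_bump_of_mem h₁ h₂
      ⟨by linarith [hs.1], by unfold halfPeriod; linarith [hs.2]⟩]
    unfold bump halfPeriod
    rw [min_eq_left (b := a₁ + a₂ + 2 - s) (by linarith [hs.2]), min_eq_right (by linarith [hs.2]),
      max_eq_right (by linarith [hs.1])]
  rw [this.deriv_eq]
  simp

/-- Joint continuity of `ψ_r` in the parameters and the argument. -/
theorem continuous_psi_uncurry {β : Type*} [TopologicalSpace β] {A₁ A₂ : β → ℝ}
    (hA₁ : Continuous A₁) (hA₂ : Continuous A₂) (h₁ : ∀ b, 0 ≤ A₁ b) (h₂ : ∀ b, 0 ≤ A₂ b) (n : ℕ) :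
    Continuous fun p : β × ℝ => psi (A₁ p.1) (A₂ p.1) (n + 1) p.2 := by
  induction n with
  | zero =>
    have hT : ∀ b, 0 < halfPeriod (A₁ b) (A₂ b) := fun b => halfPeriod_pos (h₁ b) (h₂ b)
    have hb : Continuous fun p : (β × ℝ) × ℝ => bump (A₁ p.1.1) (A₂ p.1.1) p.2 := by
      unfold bump halfPeriod; fun_prop
    have h := ContinuousOn.comp_fract (β := β × ℝ)
      (s := fun p => p.2 / (2 * halfPeriod (A₁ p.1) (A₂ p.1)))
      (f := fun p v => bump (A₁ p.1) (A₂ p.1) (2 * halfPeriod (A₁ p.1) (A₂ p.1) * v) -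
        bump (A₁ p.1) (A₂ p.1)
          (2 * halfPeriod (A₁ p.1) (A₂ p.1) * v - halfPeriod (A₁ p.1) (A₂ p.1)))
      (by
        have e1 : Continuous fun p : (β × ℝ) × ℝ =>
          ((p.1, 2 * halfPeriod (A₁ p.1.1) (A₂ p.1.1) * p.2) : (β × ℝ) × ℝ) := by
            unfold halfPeriod; fun_prop
        have e2 : Continuous fun p : (β × ℝ) × ℝ =>
          ((p.1, 2 * halfPeriod (A₁ p.1.1) (A₂ p.1.1) * p.2 -
            halfPeriod (A₁ p.1.1) (A₂ p.1.1)) : (β × ℝ) × ℝ) := by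
            unfold halfPeriod; fun_prop
        exact ((hb.comp e1).sub (hb.comp e2)).continuousOn)
      (by
        refine Continuous.div (by fun_prop) (by unfold halfPeriod; fun_prop) fun p => ?_
        linarith [hT p.1])
      (fun p => by
        have := hT p.1
        simp only [mul_zero, mul_one, zero_sub]
        rw [bump_of_le (h₁ _), bump_of_le (by linarith [h₁ p.1]), bump_of_ge (by linarith),
          bump_of_ge (by linarith)])
    refine h.congr fun p => ?_
    exact (psiOne_eq_bump_fract (h₁ _) (h₂ _) _).symm
  | succ n ih =>
    have hI : Continuous fun p : β × ℝ =>
        ∫ u in (0 : ℝ)..p.2, psi (A₁ p.1) (A₂ p.1) (n + 1) u :=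
      intervalIntegral.continuous_parametric_intervalIntegral_of_continuous
        (f := fun (p : β × ℝ) u => psi (A₁ p.1) (A₂ p.1) (n + 1) u)
        (ih.comp (g := fun p : β × ℝ => psi (A₁ p.1) (A₂ p.1) (n + 1) p.2)
          (f := fun q : (β × ℝ) × ℝ => (q.1.1, q.2)) (by fun_prop)) continuous_snd
    have hJ : Continuous fun p : β × ℝ =>
        ∫ v in (0 : ℝ)..(2 * halfPeriod (A₁ p.1) (A₂ p.1)),
          ∫ u in (0 : ℝ)..v, psi (A₁ p.1) (A₂ p.1) (n + 1) u :=
      intervalIntegral.continuous_parametric_intervalIntegral_of_continuous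
        (f := fun (p : β × ℝ) v => ∫ u in (0 : ℝ)..v, psi (A₁ p.1) (A₂ p.1) (n + 1) u)
        (hI.comp (g := fun p : β × ℝ => ∫ u in (0 : ℝ)..p.2, psi (A₁ p.1) (A₂ p.1) (n + 1) u)
          (f := fun q : (β × ℝ) × ℝ => (q.1.1, q.2)) (by fun_prop))
        (by unfold halfPeriod; fun_prop)
    refine hI.sub (Continuous.mul ?_ hJ)
    refine Continuous.div continuous_const (by unfold halfPeriod; fun_prop) fun p => ?_
    have := halfPeriod_pos (h₁ p.1) (h₂ p.1)
    linarith

theorem continuous_psi (h₁ : 0 ≤ a₁) (h₂ : 0 ≤ a₂) (n : ℕ) : Continuous (psi a₁ a₂ (n + 1)) :=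
  (continuous_psi_uncurry (β := Unit) (A₁ := fun _ => a₁) (A₂ := fun _ => a₂) continuous_const
    continuous_const (fun _ => h₁) (fun _ => h₂) n).comp (continuous_const.prodMk continuous_id :
      Continuous fun t : ℝ => ((), t))

theorem hasDerivAt_psi (h₁ : 0 ≤ a₁) (h₂ : 0 ≤ a₂) (n : ℕ) (t : ℝ) :
    HasDerivAt (psi a₁ a₂ (n + 2)) (psi a₁ a₂ (n + 1) t) t :=
  ((continuous_psi h₁ h₂ n).integral_hasStrictDerivAt 0 t).hasDerivAt.sub_const _

theorem isTower_psi (h₁ : 0 ≤ a₁) (h₂ : 0 ≤ a₂) (m n : ℕ) :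
    IsTower n fun k => psi a₁ a₂ (k + (m + 1)) := fun k _ t => by
  have := hasDerivAt_psi h₁ h₂ (k + m) t
  rwa [show k + m + 2 = k + 1 + (m + 1) by ring, show k + m + 1 = k + (m + 1) by ring] at this

theorem psi_antiperiodic (h₁ : 0 ≤ a₁) (h₂ : 0 ≤ a₂) (n : ℕ) :
    Function.Antiperiodic (psi a₁ a₂ (n + 1)) (halfPeriod a₁ a₂) := by
  have hT := halfPeriod_pos h₁ h₂
  induction n with
  | zero => exact psiOne_antiperiodic h₁ h₂
  | succ n ih =>
    set T := halfPeriod a₁ a₂ with hTdef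
    set F := psi a₁ a₂ (n + 2) with hF
    have hFc : Continuous F := continuous_psi h₁ h₂ (n + 1)
    have hd : ∀ t, HasDerivAt (fun t => F (t + T) + F t) 0 t := fun t => by
      refine (((hasDerivAt_psi h₁ h₂ n (t + T)).comp_add_const t T).add
        (hasDerivAt_psi h₁ h₂ n t)).congr_deriv ?_
      rw [ih t, neg_add_cancel]
    have hc : ∀ t, F (t + T) + F t = F (0 + T) + F 0 := fun t =>
      is_const_of_deriv_eq_zero (fun t => (hd t).differentiableAt) (fun t => (hd t).deriv) t 0
    have hmean : ∫ t in (0 : ℝ)..(2 * T), F t = 0 := by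
      have hp : Continuous fun t => ∫ u in (0 : ℝ)..t, psi a₁ a₂ (n + 1) u :=
        continuous_iff_continuousAt.2 fun t =>
          ((continuous_psi h₁ h₂ n).integral_hasStrictDerivAt 0 t).hasDerivAt.continuousAt
      have : F = zeroMeanIntegral (2 * T) (psi a₁ a₂ (n + 1)) := rfl
      rw [this]
      unfold zeroMeanIntegral
      rw [intervalIntegral.integral_sub (hp.intervalIntegrable _ _)
        (intervalIntegrable_const), intervalIntegral.integral_const, smul_eq_mul, sub_zero,
        ← mul_assoc, mul_one_div_cancel (by linarith), one_mul, sub_self]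
    have hsplit : ∫ t in (0 : ℝ)..(2 * T), F t = T * (F (0 + T) + F 0) := by
      rw [← intervalIntegral.integral_add_adjacent_intervals (b := T)
        (hFc.intervalIntegrable _ _) (hFc.intervalIntegrable _ _)]
      have : ∫ t in T..(2 * T), F t = ∫ t in (0 : ℝ)..T, F (t + T) := by
        rw [intervalIntegral.integral_comp_add_right]
        congr 1 <;> ring
      have hFT : Continuous fun t => F (t + T) := by fun_prop
      rw [this, add_comm, ← intervalIntegral.integral_add
        (hFT.intervalIntegrable _ _) (hFc.intervalIntegrable _ _)]
      simp only [hc]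
      rw [intervalIntegral.integral_const, sub_zero, smul_eq_mul]
    rw [hsplit] at hmean
    intro t
    have h0 : F (0 + T) + F 0 = 0 := (mul_eq_zero.1 hmean).resolve_left hT.ne'
    linarith [hc t]

theorem psi_periodic (h₁ : 0 ≤ a₁) (h₂ : 0 ≤ a₂) (n : ℕ) :
    Function.Periodic (psi a₁ a₂ (n + 1)) (2 * halfPeriod a₁ a₂) :=
  (psi_antiperiodic h₁ h₂ n).periodic_two_mul

theorem supAbs_psi_eq_sSup (h₁ : 0 ≤ a₁) (h₂ : 0 ≤ a₂) (n : ℕ) :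
    supAbs (psi a₁ a₂ (n + 1)) =
      sSup ((fun v => |psi a₁ a₂ (n + 1) (2 * halfPeriod a₁ a₂ * v)|) '' Icc 0 1) := by
  have hT := halfPeriod_pos h₁ h₂
  have hp : Function.Periodic (fun v => |psi a₁ a₂ (n + 1) (2 * halfPeriod a₁ a₂ * v)|) 1 :=
    fun v => by
      simp only
      rw [mul_add, mul_one, psi_periodic h₁ h₂ n]
  have h := hp.image_Icc one_pos 0
  rw [zero_add] at h
  rw [h, ← iSup, supAbs]
  exact ((mul_left_surjective₀ (by linarith)).iSup_comp (fun t => |psi a₁ a₂ (n + 1) t|)).symm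

theorem exists_bound_psi (h₁ : 0 ≤ a₁) (h₂ : 0 ≤ a₂) (n : ℕ) :
    ∃ C, ∀ t, |psi a₁ a₂ (n + 1) t| ≤ C := by
  have hT := halfPeriod_pos h₁ h₂
  obtain ⟨C, hC⟩ := isCompact_Icc.exists_bound_of_continuousOn
    (s := Icc 0 (2 * halfPeriod a₁ a₂)) (continuous_psi h₁ h₂ n).continuousOn
  refine ⟨C, fun t => ?_⟩
  obtain ⟨s, hs, hst⟩ := (psi_periodic h₁ h₂ n).exists_mem_Ico₀ (by linarith) t
  rw [hst]
  exact hC s (Ico_subset_Icc_self hs)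

theorem continuous_supAbs_psi {β : Type*} [TopologicalSpace β] {A₁ A₂ : β → ℝ}
    (hA₁ : Continuous A₁) (hA₂ : Continuous A₂) (h₁ : ∀ b, 0 ≤ A₁ b) (h₂ : ∀ b, 0 ≤ A₂ b) (n : ℕ) :
    Continuous fun b => supAbs (psi (A₁ b) (A₂ b) (n + 1)) := by
  simp only [fun b => supAbs_psi_eq_sSup (h₁ b) (h₂ b) n]
  refine isCompact_Icc.continuous_sSup
    (f := fun b v => |psi (A₁ b) (A₂ b) (n + 1) (2 * halfPeriod (A₁ b) (A₂ b) * v)|) ?_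
  have := continuous_psi_uncurry hA₁ hA₂ h₁ h₂ n
  refine (this.comp (f := fun p : β × ℝ => (p.1, 2 * halfPeriod (A₁ p.1) (A₂ p.1) * p.2)) ?_).abs
  unfold halfPeriod
  fun_prop

theorem psi_two_sub (h₁ : 0 ≤ a₁) (h₂ : 0 ≤ a₂) :
    psi a₁ a₂ 2 (halfPeriod a₁ a₂) - psi a₁ a₂ 2 0 = 1 + a₂ := by
  have hd : ∀ t, HasDerivAt (psi a₁ a₂ 2) (psiOne a₁ a₂ t) t := hasDerivAt_psi h₁ h₂ 0
  have hmem : ∀ t, 0 ≤ t → t ≤ a₁ + a₂ + 2 → psiOne a₁ a₂ t =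
      max 0 (min 1 (min (t - a₁) (a₁ + a₂ + 2 - t))) := fun t h3 h4 =>
    psiOne_eq_bump_of_mem h₁ h₂ ⟨h3, h4⟩
  have hsq : ∀ c t : ℝ, HasDerivAt (fun t => (t - c) ^ 2 / 2) (t - c) t := fun c t => by
    refine ((((hasDerivAt_id t).sub_const c).pow 2).div_const 2).congr_deriv ?_
    simp
  have e1 := sub_eq_sub_of_hasDerivAt_eq (a := 0) (b := a₁) h₁ hd
    (fun t => hasDerivAt_const t (0 : ℝ)) fun t ht => by
      rw [hmem t ht.1 (by linarith [ht.2])]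
      exact bump_of_le ht.2
  have e2 := sub_eq_sub_of_hasDerivAt_eq (a := a₁) (b := a₁ + 1) (by linarith) hd
    (hsq a₁) fun t ht => by
      rw [hmem t (by linarith [ht.1]) (by linarith [ht.2]), min_eq_left (a := t - a₁)
        (by linarith [ht.2]), min_eq_right (by linarith [ht.2]), max_eq_right (by linarith [ht.1])]
  have e3 := sub_eq_sub_of_hasDerivAt_eq (a := a₁ + 1) (b := a₁ + 1 + a₂) (by linarith) hd
    (fun t => hasDerivAt_id t) fun t ht => by
      rw [hmem t (by linarith [ht.1]) (by linarith [ht.2]), min_eq_left (a := (1 : ℝ))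
        (le_min (by linarith [ht.1]) (by linarith [ht.2])), max_eq_right zero_le_one]
  have e4 := sub_eq_sub_of_hasDerivAt_eq (a := a₁ + 1 + a₂) (b := a₁ + a₂ + 2) (by linarith) hd
    (fun t => (hsq (a₁ + a₂ + 2) t).neg) fun t ht => by
      rw [hmem t (by linarith [ht.1]) (by linarith [ht.2]), min_eq_right (a := t - a₁)
        (by linarith [ht.1]), min_eq_right (by linarith [ht.1]), max_eq_right (by linarith [ht.2])]
      ring
  unfold halfPeriod
  simp only [id_eq, Pi.neg_apply] at e1 e2 e3 e4
  linarith

theorem psi_two_zero (h₁ : 0 ≤ a₁) (h₂ : 0 ≤ a₂) : psi a₁ a₂ 2 0 = -((1 + a₂) / 2) := by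
  have e1 := psi_antiperiodic h₁ h₂ 1 0
  have e2 := psi_two_sub h₁ h₂
  rw [zero_add] at e1
  norm_num at e1
  linarith

theorem supAbs_psi_two (h₁ : 0 ≤ a₁) (h₂ : 0 ≤ a₂) : supAbs (psi a₁ a₂ 2) = (1 + a₂) / 2 := by
  have hT := halfPeriod_pos h₁ h₂
  have e0 := psi_two_zero h₁ h₂
  have eT := psi_two_sub h₁ h₂
  have hd : ∀ t, HasDerivAt (psi a₁ a₂ 2) (psiOne a₁ a₂ t) t := hasDerivAt_psi h₁ h₂ 0
  refine le_antisymm (supAbs_le fun t => ?_) ?_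
  · have hp : Function.Periodic (fun t => |psi a₁ a₂ 2 t|) (halfPeriod a₁ a₂) := fun t => by
      simp only
      rw [psi_antiperiodic h₁ h₂ 1 t, abs_neg]
    obtain ⟨s, hs, hst⟩ := hp.exists_mem_Ico₀ hT t
    rw [show |psi a₁ a₂ 2 t| = |psi a₁ a₂ 2 s| from hst]
    have hnn : ∀ t ∈ Icc 0 (halfPeriod a₁ a₂), 0 ≤ psiOne a₁ a₂ t := fun t ht => by
      rw [psiOne_eq_bump_of_mem h₁ h₂ ht]; exact bump_nonneg t
    have i1 := sub_le_sub_of_hasDerivAt_le hs.1 (fun t => hasDerivAt_const t (0 : ℝ)) hd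
      fun t ht => hnn t ⟨ht.1, ht.2.trans hs.2.le⟩
    have i2 := sub_le_sub_of_hasDerivAt_le hs.2.le (fun t => hasDerivAt_const t (0 : ℝ)) hd
      fun t ht => hnn t ⟨hs.1.trans ht.1, ht.2⟩
    exact abs_le.2 ⟨by linarith, by linarith⟩
  · have := le_supAbs (exists_bound_psi h₁ h₂ 1) 0
    rwa [show (1 + 1 : ℕ) = 2 from rfl, e0, abs_neg, abs_of_nonneg (by linarith)] at this

theorem le_supAbs_psi_three (h₁ : 0 ≤ a₁) (h₂ : 0 ≤ a₂) :
    a₁ * (1 + a₂) / 4 ≤ supAbs (psi a₁ a₂ 3) := by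
  have h2 : ∀ t ∈ Icc 0 a₁, psi a₁ a₂ 2 t = -((1 + a₂) / 2) := fun t ht => by
    have := sub_eq_sub_of_hasDerivAt_eq ht.1 (hasDerivAt_psi h₁ h₂ 0)
      (fun t => hasDerivAt_const t (0 : ℝ)) fun s hs => by
        refine (psiOne_eq_bump_of_mem h₁ h₂ ⟨hs.1, ?_⟩).trans (bump_of_le (hs.2.trans ht.2))
        unfold halfPeriod
        linarith [hs.2, ht.2]
    rw [zero_add, psi_two_zero h₁ h₂] at this
    linarith
  have h3 := sub_eq_sub_of_hasDerivAt_eq h₁ (hasDerivAt_psi h₁ h₂ 1)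
    (fun t => by simpa using (hasDerivAt_id t).const_mul (-((1 + a₂) / 2))) h2
  have h4 := abs_le.1 (le_supAbs (exists_bound_psi h₁ h₂ 2) 0)
  have h5 := abs_le.1 (le_supAbs (exists_bound_psi h₁ h₂ 2) a₁)
  norm_num at h3 h4 h5
  linarith [h4.2, h5.1]

/-- The norm of `ψ_r(a₁, a₂; ·)`, `r ≥ 2`, is unbounded as `a₂` grows. -/
theorem exists_le_supAbs_psi_right (h₁ : 0 ≤ a₁) (n : ℕ) (K : ℝ) :
    ∃ a₂, 0 ≤ a₂ ∧ K ≤ supAbs (psi a₁ a₂ (n + 2)) := by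
  obtain ⟨a₂, h₂, ha₂⟩ : ∃ a₂ : ℝ, 0 ≤ a₂ ∧ 2 * (2 ^ n * K + n) ≤ a₂ :=
    ⟨_, le_max_left _ _, le_max_right _ _⟩
  refine ⟨a₂, h₂, ?_⟩
  have h := (isTower_psi h₁ h₂ 1 n).abs_zero_le zero_le_one
    (abs_sub_le_of_hasDerivAt (fun t => hasDerivAt_psi h₁ h₂ 0 t)
      (abs_psiOne_le_one h₁ h₂)) (le_supAbs (exists_bound_psi h₁ h₂ (n + 1)))
  have h' := supAbs_le h
  norm_num at h'
  rw [supAbs_psi_two h₁ h₂] at h'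
  refine le_of_mul_le_mul_left ?_ (pow_pos two_pos n : (0 : ℝ) < 2 ^ n)
  linarith

/-- The norm of `ψ_r(a₁, a₂; ·)`, `r ≥ 3`, is unbounded as `a₁` grows. -/
theorem exists_le_supAbs_psi_left (h₂ : 0 ≤ a₂) (n : ℕ) (K : ℝ) :
    ∃ a₁, 0 ≤ a₁ ∧ K ≤ supAbs (psi a₁ a₂ (n + 3)) := by
  obtain ⟨a₁, h₁, ha₁⟩ : ∃ a₁ : ℝ, 0 ≤ a₁ ∧ 4 * (2 ^ n * K + n * ((1 + a₂) / 2)) ≤ a₁ :=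
    ⟨_, le_max_left _ _, le_max_right _ _⟩
  refine ⟨a₁, h₁, ?_⟩
  have h := (isTower_psi h₁ h₂ 2 n).abs_zero_le (by linarith : 0 ≤ (1 + a₂) / 2)
    (abs_sub_le_of_hasDerivAt (fun t => hasDerivAt_psi h₁ h₂ 1 t)
      fun t => by
        rw [← supAbs_psi_two h₁ h₂]
        exact le_supAbs (exists_bound_psi h₁ h₂ 1) t)
    (le_supAbs (exists_bound_psi h₁ h₂ (n + 2)))
  have h' := supAbs_le h
  norm_num at h'
  have h3 := le_supAbs_psi_three h₁ h₂
  refine le_of_mul_le_mul_left ?_ (pow_pos two_pos n : (0 : ℝ) < 2 ^ n)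
  nlinarith

end PsiFunctions

/-- For `a₁ = 0` the functions `ψ_r`, suitably translated, are waves. -/
theorem isWaveTower_psi {a : ℝ} (ha : 0 ≤ a) :
    IsWaveTower (1 + a / 2) fun k t => psi 0 a (k + 1) (t + (k + 1) * (1 + a / 2)) := by
  have hT : halfPeriod 0 a = 2 * (1 + a / 2) := by unfold halfPeriod; ring
  have hh : 0 < 1 + a / 2 := by linarith
  have hanti : ∀ k : ℕ, Function.Antiperiodic
      (fun t => psi 0 a (k + 1) (t + (k + 1) * (1 + a / 2))) (2 * (1 + a / 2)) := fun k t => by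
    simp only
    rw [show t + 2 * (1 + a / 2) + (k + 1) * (1 + a / 2) =
      t + (k + 1) * (1 + a / 2) + 2 * (1 + a / 2) by ring, ← hT, psi_antiperiodic le_rfl ha]
  have hderiv : ∀ (k : ℕ) (t : ℝ), HasDerivAt
      (fun t => psi 0 a (k + 1 + 1) (t + ((k + 1 : ℕ) + 1) * (1 + a / 2)))
      (psi 0 a (k + 1) (t + (1 + a / 2) + (k + 1) * (1 + a / 2))) t := fun k t => by
    refine ((hasDerivAt_psi le_rfl ha k _).comp_add_const t _).congr_deriv ?_
    congr 1
    push_cast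
    ring
  set h := 1 + a / 2 with hdef
  have hbump : ∀ t, |t| ≤ h → psi 0 a (0 + 1) (t + ((0 : ℕ) + 1) * h) =
      max 0 (min 1 (h - |t|)) := fun t ht => by
    have h3 := abs_le.1 ht
    have h4 : psi 0 a (0 + 1) (t + ((0 : ℕ) + 1) * h) = psiOne 0 a (t + h) := by
      simp [psi]
    rw [h4, psiOne_eq_bump_of_mem le_rfl ha ⟨by linarith, by rw [hT]; linarith⟩]
    unfold bump
    rw [hT]
    congr 2
    rcases abs_cases t with ⟨h5, h6⟩ | ⟨h5, h6⟩ <;> rw [h5]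
    · rw [min_eq_right (by linarith)]; ring
    · rw [min_eq_left (by linarith)]; ring
  refine ⟨fun k => ?_, hderiv, by linarith, fun t ht => ?_⟩
  · induction k with
    | zero =>
      refine ⟨hh, (continuous_psi le_rfl ha 0).comp (by fun_prop), hanti 0, fun t => ?_,
        fun t ht => ?_⟩
      · have hp : Function.Periodic (fun t => |psi 0 a (0 + 1) (-t + ((0 : ℕ) + 1) * h) -
            psi 0 a (0 + 1) (t + ((0 : ℕ) + 1) * h)|) (2 * h) := fun t => by
          have e1 := hanti 0 t
          have e2 := hanti 0 (-(t + 2 * h))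
          simp only at e1 e2 ⊢
          rw [show -(t + 2 * h) + 2 * h = -t by ring] at e2
          rw [e1, e2, sub_neg_eq_add, ← abs_neg]
          congr 1; ring
        obtain ⟨s, hs, hst⟩ := hp.exists_mem_Ico (by linarith) t (-h)
        have hs' : |s| ≤ h := abs_le.2 ⟨hs.1, by linarith [hs.2]⟩
        rw [hbump s hs', hbump (-s) (by rwa [abs_neg]), abs_neg, sub_self, abs_zero,
          abs_eq_zero, sub_eq_zero] at hst
        exact hst
      · rw [hbump t ht.le]
        exact lt_max_of_lt_right (lt_min one_pos (by linarith))
    | succ k ih => exact ih.primitive (hderiv k) (hanti (k + 1))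
  · rw [hbump t (by rw [abs_of_nonneg ht.1]; exact ht.2), abs_of_nonneg ht.1]
    exact max_eq_right (le_min zero_le_one (by linarith [ht.2]))

theorem supAbs_comp_add (f : ℝ → ℝ) (c : ℝ) : supAbs (fun t => f (t + c)) = supAbs f :=
  (add_right_surjective c).iSup_comp (fun t => |f t|)

theorem supAbs_psi_eq_wave {a : ℝ} (ha : 0 ≤ a) (k : ℕ) :
    supAbs (psi 0 a (k + 1)) = psi 0 a (k + 1) (0 + (k + 1) * (1 + a / 2)) := by
  cases k with
  | zero => exact (supAbs_psiOne le_rfl ha).trans (isWaveTower_psi ha).zero_zero.symm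
  | succ k =>
    rw [← supAbs_comp_add _ (((k + 1 : ℕ) + 1) * (1 + a / 2))]
    exact (isWaveTower_psi ha).supAbs_succ k

/-! ### Matching the norms of a normalized tower -/

/-- A tower whose bottom function is `1`-Lipschitz with supremum `1` is at least as large as the
tower of triangular waves; this is the Landau–Kolmogorov inequality for the derivative of
order `r - 1`. -/
theorem supAbs_psi_le_of_supAbs_zero {n : ℕ} {v : ℕ → ℝ → ℝ} (hv : IsTower n v)
    (hlip : ∀ s t, |v 0 s - v 0 t| ≤ |s - t|) (hone : ∀ t, |v 0 t| ≤ 1)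
    (hbd : ∃ B, ∀ t, |v n t| ≤ B) (h0 : supAbs (v 0) = 1) :
    supAbs (psi 0 0 (n + 1)) ≤ supAbs (v n) := by
  rw [supAbs_psi_eq_wave le_rfl]
  have hw := isWaveTower_psi (le_refl (0 : ℝ))
  exact hw.le_supAbs_of_le (.inr (by norm_num)) (Nat.zero_le n) hv hlip hone hbd
    (by rw [hw.zero_zero, h0])

/-- If the norms of the bottom function `v 0` and of `v 1` are at most, respectively equal to, those
for `ψ_r(0, a; ·)`, then `v n` is at least as large as `ψ_r(0, a; ·)`. -/
theorem supAbs_psi_le_of_supAbs_one {n : ℕ} (hn : 1 ≤ n) {a : ℝ} (ha : 0 ≤ a) {v : ℕ → ℝ → ℝ}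
    (hv : IsTower n v) (hlip : ∀ s t, |v 0 s - v 0 t| ≤ |s - t|) (hone : ∀ t, |v 0 t| ≤ 1)
    (hbd : ∃ B, ∀ t, |v n t| ≤ B) (h1 : supAbs (v 1) = (1 + a) / 2) :
    supAbs (psi 0 a (n + 1)) ≤ supAbs (v n) := by
  rw [supAbs_psi_eq_wave ha]
  refine (isWaveTower_psi ha).le_supAbs_of_le (.inl le_rfl) hn hv hlip hone hbd ?_
  rw [← supAbs_psi_eq_wave ha 1, h1]
  exact (supAbs_psi_two le_rfl ha).le

/-- The Landau inequality: if `v 1` is as large as the triangular wave spline of order `2`, and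
its derivative `v 0` is `1`-Lipschitz, then `|v 0| ≤ 1`. -/
theorem abs_zero_le_one_of_supAbs_one {n : ℕ} (hn : 1 ≤ n) {v : ℕ → ℝ → ℝ} (hv : IsTower n v)
    (hlip : ∀ s t, |v 0 s - v 0 t| ≤ |s - t|) (hb0 : ∃ B, ∀ t, |v 0 t| ≤ B)
    (hb1 : ∃ B, ∀ t, |v 1 t| ≤ B) (h1 : supAbs (v 1) = 1 / 2) (t : ℝ) : |v 0 t| ≤ 1 := by
  refine (le_supAbs hb0 t).trans ?_
  by_contra! hm
  -- Scaled down by the norm of `v 0`, the tower would violate the Landau inequality.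
  set m := supAbs (v 0) with hmdef
  have hm0 : 0 < m := by linarith
  have hinv : |m⁻¹| = m⁻¹ := abs_of_pos (inv_pos.2 hm0)
  have hsup : ∀ k, supAbs (fun t => m⁻¹ * v k t) = m⁻¹ * supAbs (v k) := fun k => by
    have := supAbs_const_mul_comp m⁻¹ one_ne_zero (v k)
    simpa [hinv] using this
  have h2 := supAbs_psi_le_of_supAbs_zero ((hv.mono hn).const_mul m⁻¹)
    (fun s t => by
      rw [← mul_sub, abs_mul, hinv]
      exact (mul_le_of_le_one_left (abs_nonneg _) (inv_le_one_of_one_le₀ hm.le)).trans (hlip s t))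
    (fun t => by
      rw [abs_mul, hinv, inv_mul_le_one₀ hm0]
      exact le_supAbs hb0 t)
    (by
      obtain ⟨B, hB⟩ := hb1
      exact ⟨m⁻¹ * B, fun t => by
        rw [abs_mul, hinv]; exact mul_le_mul_of_nonneg_left (hB t) (inv_pos.2 hm0).le⟩)
    (by rw [hsup, ← hmdef, inv_mul_cancel₀ hm0.ne'])
  rw [hsup, h1, show supAbs (psi 0 0 (1 + 1)) = (1 + 0) / 2 from supAbs_psi_two le_rfl le_rfl] at h2
  have h3 : m⁻¹ < 1 := inv_lt_one_of_one_lt₀ hm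
  linarith

theorem exists_supAbs_psi_eq_right (n : ℕ) {K : ℝ} (hK : supAbs (psi 0 0 (n + 2)) ≤ K) :
    ∃ a₂, 0 ≤ a₂ ∧ supAbs (psi 0 a₂ (n + 2)) = K := by
  have hc := continuous_supAbs_psi (A₁ := fun _ : ℝ => 0) (A₂ := fun b : ℝ => |b|)
    continuous_const continuous_abs (fun _ => le_rfl) abs_nonneg (n + 1)
  obtain ⟨a, ha, haK⟩ := exists_le_supAbs_psi_right (le_refl (0 : ℝ)) n K
  obtain ⟨b, hb⟩ := mem_range_of_exists_le_of_exists_ge (c := K) hc ⟨0, by simpa using hK⟩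
    ⟨a, by simpa [abs_of_nonneg ha] using haK⟩
  exact ⟨|b|, abs_nonneg b, hb⟩

theorem exists_supAbs_psi_eq_left (n : ℕ) {a₂ K : ℝ} (h₂ : 0 ≤ a₂)
    (hK : supAbs (psi 0 a₂ (n + 3)) ≤ K) : ∃ a₁, 0 ≤ a₁ ∧ supAbs (psi a₁ a₂ (n + 3)) = K := by
  have hc := continuous_supAbs_psi (A₁ := fun b : ℝ => |b|) (A₂ := fun _ : ℝ => a₂)
    continuous_abs continuous_const abs_nonneg (fun _ => h₂) (n + 2)
  obtain ⟨a, ha, haK⟩ := exists_le_supAbs_psi_left h₂ n K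
  obtain ⟨b, hb⟩ := mem_range_of_exists_le_of_exists_ge (c := K) hc ⟨0, by simpa using hK⟩
    ⟨a, by simpa [abs_of_nonneg ha] using haK⟩
  exact ⟨|b|, abs_nonneg b, hb⟩

section Normalized

variable {n : ℕ} {v : ℕ → ℝ → ℝ} (hv : IsTower n v)
  (hlip : ∀ s t, |v 0 s - v 0 t| ≤ |s - t|) (hb : ∀ k ≤ n, ∃ B, ∀ t, |v k t| ≤ B)
include hv hlip hb

theorem exists_match_zero (h0 : supAbs (v 0) = 1) :
    ∃ a₂, 0 ≤ a₂ ∧ supAbs (psi 0 a₂ (n + 1)) = supAbs (v n) := by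
  have hone : ∀ t, |v 0 t| ≤ 1 := fun t => h0 ▸ le_supAbs (hb 0 (Nat.zero_le n)) t
  cases n with
  | zero => exact ⟨0, le_rfl, (supAbs_psiOne le_rfl le_rfl).trans h0.symm⟩
  | succ n =>
    exact exists_supAbs_psi_eq_right n
      (supAbs_psi_le_of_supAbs_zero hv hlip hone (hb _ le_rfl) h0)

theorem exists_match_one (hn : 1 ≤ n) (h1 : supAbs (v 1) = 1 / 2) :
    ∃ a₁, 0 ≤ a₁ ∧ supAbs (psi a₁ 0 (n + 1)) = supAbs (v n) := by
  have hone := abs_zero_le_one_of_supAbs_one hn hv hlip (hb 0 (Nat.zero_le n)) (hb 1 hn) h1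
  obtain rfl | ⟨n, rfl⟩ : n = 1 ∨ ∃ m, n = m + 2 := by
    rcases hn.eq_or_lt with h | h
    · exact .inl h.symm
    · exact .inr ⟨n - 2, by omega⟩
  · refine ⟨0, le_rfl, (supAbs_psi_two le_rfl le_rfl).trans ?_⟩
    rw [h1, add_zero]
  · exact exists_supAbs_psi_eq_left n le_rfl
      (supAbs_psi_le_of_supAbs_one hn le_rfl hv hlip hone (hb _ le_rfl) (by rw [h1, add_zero]))

theorem exists_match_zero_one (h0 : supAbs (v 0) = 1) :
    ∃ a₁ a₂, 0 ≤ a₁ ∧ 0 ≤ a₂ ∧ (1 ≤ n → supAbs (psi a₁ a₂ 2) = supAbs (v 1)) ∧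
      supAbs (psi a₁ a₂ (n + 1)) = supAbs (v n) := by
  have hone : ∀ t, |v 0 t| ≤ 1 := fun t => h0 ▸ le_supAbs (hb 0 (Nat.zero_le n)) t
  rcases Nat.eq_zero_or_pos n with rfl | hn
  · exact ⟨0, 0, le_rfl, le_rfl, fun h => absurd h (by norm_num),
      (supAbs_psiOne le_rfl le_rfl).trans h0.symm⟩
  have hhalf := supAbs_psi_le_of_supAbs_zero (hv.mono hn) hlip hone (hb 1 hn) h0
  rw [show supAbs (psi 0 0 (1 + 1)) = (1 + 0) / 2 from supAbs_psi_two le_rfl le_rfl] at hhalf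
  -- The parameter `a₂` is determined by the norm of `ψ₂`, which is `(1 + a₂) / 2`.
  set a₂ := 2 * supAbs (v 1) - 1 with ha₂
  have h₂ : 0 ≤ a₂ := by linarith
  have h1 : supAbs (v 1) = (1 + a₂) / 2 := by rw [ha₂]; ring
  obtain rfl | ⟨n, rfl⟩ : n = 1 ∨ ∃ m, n = m + 2 := by
    rcases Nat.eq_or_lt_of_le hn with h | h
    · exact .inl h.symm
    · exact .inr ⟨n - 2, by omega⟩
  · have h2 := (supAbs_psi_two le_rfl h₂).trans h1.symm
    exact ⟨0, a₂, le_rfl, h₂, fun _ => h2, h2⟩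
  · obtain ⟨a₁, h₁, ha₁⟩ := exists_supAbs_psi_eq_left n h₂
      (supAbs_psi_le_of_supAbs_one hn h₂ hv hlip hone (hb _ le_rfl) h1)
    exact ⟨a₁, a₂, h₁, h₂, fun _ => (supAbs_psi_two h₁ h₂).trans h1.symm, ha₁⟩

end Normalized

/-! ### Rescaling -/

/-- The tower `u` rescaled in the argument by `μ` and in amplitude so that a Lipschitz constant `L`
of `u 0` becomes `1`. -/
def rescale (L μ : ℝ) (u : ℕ → ℝ → ℝ) (k : ℕ) (t : ℝ) : ℝ := (L * μ ^ (k + 1))⁻¹ * u k (μ * t)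

section Rescale

variable {n : ℕ} {u : ℕ → ℝ → ℝ} {L μ : ℝ}

theorem IsTower.rescale (hu : IsTower n u) (hL : 0 < L) (hμ : 0 < μ) :
    IsTower n (rescale L μ u) := by
  intro k hk t
  have h := ((hu k hk (μ * t)).comp t
    (by simpa using (hasDerivAt_id t).const_mul μ)).const_mul (L * μ ^ (k + 1 + 1))⁻¹
  refine h.congr_deriv ?_
  unfold RodovSpline.rescale
  field_simp
  ring

theorem supAbs_rescale (hL : 0 < L) (hμ : 0 < μ) (k : ℕ) :
    supAbs (rescale L μ u k) = supAbs (u k) / (L * μ ^ (k + 1)) := by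
  have h := supAbs_const_mul_comp (L * μ ^ (k + 1))⁻¹ hμ.ne' (u k)
  rw [abs_of_pos (by positivity)] at h
  rw [div_eq_inv_mul, ← h]
  rfl

theorem rescale_lipschitz (hL : 0 < L) (hμ : 0 < μ)
    (hlip : ∀ s t, |u 0 s - u 0 t| ≤ L * |s - t|) (s t : ℝ) :
    |rescale L μ u 0 s - rescale L μ u 0 t| ≤ |s - t| := by
  unfold rescale
  have h := hlip (μ * s) (μ * t)
  rw [← mul_sub, abs_mul, abs_of_pos hμ] at h
  rw [← mul_sub, abs_mul, abs_of_pos (by positivity), zero_add, pow_one,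
    inv_mul_le_iff₀ (by positivity)]
  linarith

theorem exists_bound_rescale {k : ℕ} (h : ∃ B, ∀ t, |u k t| ≤ B) :
    ∃ B, ∀ t, |rescale L μ u k t| ≤ B := by
  obtain ⟨B, hB⟩ := h
  refine ⟨|(L * μ ^ (k + 1))⁻¹| * B, fun t => ?_⟩
  unfold rescale
  rw [abs_mul]
  exact mul_le_mul_of_nonneg_left (hB _) (abs_nonneg _)

variable (hu : IsTower n u) (hL : 0 < L) (hlip : ∀ s t, |u 0 s - u 0 t| ≤ L * |s - t|)
  (hb : ∀ k ≤ n, ∃ B, ∀ t, |u k t| ≤ B) (h0 : 0 < supAbs (u 0))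
include hu hL hlip hb h0

theorem exists_scaled_match_zero_one :
    ∃ a₁ a₂ μ, 0 ≤ a₁ ∧ 0 ≤ a₂ ∧ 0 < μ ∧
      L * μ ^ (0 + 1) * supAbs (psi a₁ a₂ (0 + 1)) = supAbs (u 0) ∧
      (1 ≤ n → L * μ ^ (1 + 1) * supAbs (psi a₁ a₂ (1 + 1)) = supAbs (u 1)) ∧
      L * μ ^ (n + 1) * supAbs (psi a₁ a₂ (n + 1)) = supAbs (u n) := by
  have hμ : 0 < supAbs (u 0) / L := div_pos h0 hL
  set μ := supAbs (u 0) / L with hμdef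
  have hLμ : L * μ = supAbs (u 0) := mul_div_cancel₀ _ hL.ne'
  obtain ⟨a₁, a₂, h₁, h₂, e1, e2⟩ := exists_match_zero_one (hu.rescale hL hμ)
    (rescale_lipschitz hL hμ hlip) (fun k hk => exists_bound_rescale (hb k hk))
    (by rw [supAbs_rescale hL hμ, zero_add, pow_one, hLμ, div_self h0.ne'])
  refine ⟨a₁, a₂, μ, h₁, h₂, hμ, ?_, fun hn => ?_, ?_⟩
  · rw [zero_add, pow_one, hLμ, show supAbs (psi a₁ a₂ 1) = 1 from supAbs_psiOne h₁ h₂, mul_one]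
  · rw [e1 hn, supAbs_rescale hL hμ, mul_div_cancel₀ _ (by positivity)]
  · rw [e2, supAbs_rescale hL hμ, mul_div_cancel₀ _ (by positivity)]

theorem exists_scaled_match_zero :
    ∃ a₂ μ, 0 ≤ a₂ ∧ 0 < μ ∧
      L * μ ^ (0 + 1) * supAbs (psi 0 a₂ (0 + 1)) = supAbs (u 0) ∧
      L * μ ^ (n + 1) * supAbs (psi 0 a₂ (n + 1)) = supAbs (u n) := by
  have hμ : 0 < supAbs (u 0) / L := div_pos h0 hL
  set μ := supAbs (u 0) / L with hμdef
  have hLμ : L * μ = supAbs (u 0) := mul_div_cancel₀ _ hL.ne'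
  obtain ⟨a₂, h₂, e2⟩ := exists_match_zero (hu.rescale hL hμ)
    (rescale_lipschitz hL hμ hlip) (fun k hk => exists_bound_rescale (hb k hk))
    (by rw [supAbs_rescale hL hμ, zero_add, pow_one, hLμ, div_self h0.ne'])
  refine ⟨a₂, μ, h₂, hμ, ?_, ?_⟩
  · rw [zero_add, pow_one, hLμ, show supAbs (psi 0 a₂ 1) = 1 from supAbs_psiOne le_rfl h₂, mul_one]
  · rw [e2, supAbs_rescale hL hμ, mul_div_cancel₀ _ (by positivity)]

theorem exists_scaled_match_one :
    ∃ a₁ μ, 0 ≤ a₁ ∧ 0 < μ ∧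
      (1 ≤ n → L * μ ^ (1 + 1) * supAbs (psi a₁ 0 (1 + 1)) = supAbs (u 1)) ∧
      L * μ ^ (n + 1) * supAbs (psi a₁ 0 (n + 1)) = supAbs (u n) := by
  rcases Nat.eq_zero_or_pos n with rfl | hn
  · obtain ⟨a₂, μ, h₂, hμ, -, e2⟩ := exists_scaled_match_zero hu hL hlip hb h0
    refine ⟨0, μ, le_rfl, hμ, fun h => absurd h (by norm_num), ?_⟩
    rwa [show supAbs (psi 0 a₂ (0 + 1)) = supAbs (psi 0 0 (0 + 1)) from
      (supAbs_psiOne le_rfl h₂).trans (supAbs_psiOne le_rfl le_rfl).symm] at e2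
  have h1 : 0 < supAbs (u 1) := by
    refine (supAbs_nonneg _).lt_of_ne fun h => h0.ne' ?_
    have hz : ∀ t, u 1 t = 0 := fun t => abs_nonpos_iff.1 (h ▸ le_supAbs (hb 1 hn) t)
    have hz' : ∀ t, u 0 t = 0 := fun t => by
      have := (hu 0 hn t).deriv
      rw [zero_add, funext hz, deriv_const] at this
      exact this.symm
    simp [supAbs, hz']
  have hμ : 0 < √(2 * supAbs (u 1) / L) := Real.sqrt_pos.2 (by positivity)
  set μ := √(2 * supAbs (u 1) / L) with hμdef
  have hLμ : L * μ ^ 2 = 2 * supAbs (u 1) := by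
    rw [hμdef, Real.sq_sqrt (by positivity), mul_div_cancel₀ _ hL.ne']
  obtain ⟨a₁, h₁, e2⟩ := exists_match_one (hu.rescale hL hμ)
    (rescale_lipschitz hL hμ hlip) (fun k hk => exists_bound_rescale (hb k hk)) hn
    (by
      rw [supAbs_rescale hL hμ, one_add_one_eq_two, hLμ]
      field_simp)
  refine ⟨a₁, μ, h₁, hμ, fun _ => ?_, ?_⟩
  · rw [one_add_one_eq_two, hLμ, supAbs_psi_two h₁ le_rfl]
    ring
  · rw [e2, supAbs_rescale hL hμ, mul_div_cancel₀ _ (by positivity)]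

end Rescale

/-! ### The norms of the derivatives of `Ψ` -/

/-- The function `Ψ` of order `n + 1` in terms of the scale `μ = λ / (2T)`. -/
def scaledPsi (a₁ a₂ b μ : ℝ) (n : ℕ) (t : ℝ) : ℝ := b * μ ^ (n + 1) * psi a₁ a₂ (n + 1) (μ⁻¹ * t)

section ScaledPsi

variable {a₁ a₂ b μ : ℝ}

theorem Psi_eq_scaledPsi (h₁ : 0 ≤ a₁) (h₂ : 0 ≤ a₂) (n : ℕ) :
    Psi (n + 1) a₁ a₂ b (μ * (2 * a₁ + 2 * a₂ + 4)) = scaledPsi a₁ a₂ b μ n := by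
  have h : 2 * a₁ + 2 * a₂ + 4 ≠ 0 := by linarith
  funext t
  unfold Psi scaledPsi
  rw [mul_div_cancel_right₀ _ h, mul_comm μ, div_mul_cancel_left₀ h]

theorem deriv_scaledPsi_succ (h₁ : 0 ≤ a₁) (h₂ : 0 ≤ a₂) (hμ : 0 < μ) (n : ℕ) :
    deriv (scaledPsi a₁ a₂ b μ (n + 1)) = scaledPsi a₁ a₂ b μ n := by
  funext t
  have h := ((hasDerivAt_psi h₁ h₂ n (μ⁻¹ * t)).comp t
    (by simpa using (hasDerivAt_id t).const_mul μ⁻¹)).const_mul (b * μ ^ (n + 1 + 1))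
  refine (h.congr_deriv ?_).deriv
  unfold scaledPsi
  field_simp
  ring

theorem iteratedDeriv_scaledPsi (h₁ : 0 ≤ a₁) (h₂ : 0 ≤ a₂) (hμ : 0 < μ) (m k : ℕ) :
    iteratedDeriv m (scaledPsi a₁ a₂ b μ (k + m)) = scaledPsi a₁ a₂ b μ k := by
  induction m with
  | zero => exact iteratedDeriv_zero
  | succ m ih => rw [iteratedDeriv_succ', ← add_assoc, deriv_scaledPsi_succ h₁ h₂ hμ, ih]

theorem supNorm_scaledPsi (h₁ : 0 ≤ a₁) (h₂ : 0 ≤ a₂) (hb : 0 < b) (hμ : 0 < μ) (k : ℕ) :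
    supNorm (scaledPsi a₁ a₂ b μ k) =
      ENNReal.ofReal (b * μ ^ (k + 1) * supAbs (psi a₁ a₂ (k + 1))) := by
  have hc : Continuous (scaledPsi a₁ a₂ b μ k) :=
    continuous_const.mul ((continuous_psi h₁ h₂ k).comp (continuous_const_mul _))
  have hbd : ∃ C, ∀ t, |scaledPsi a₁ a₂ b μ k t| ≤ C := by
    obtain ⟨C, hC⟩ := exists_bound_psi h₁ h₂ k
    refine ⟨|b * μ ^ (k + 1)| * C, fun t => ?_⟩
    unfold scaledPsi
    rw [abs_mul]
    exact mul_le_mul_of_nonneg_left (hC _) (abs_nonneg _)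
  rw [supNorm_eq_ofReal_supAbs hc hbd]
  congr 1
  have h := supAbs_const_mul_comp (b * μ ^ (k + 1)) (inv_pos.2 hμ).ne' (psi a₁ a₂ (k + 1))
  rwa [abs_of_pos (by positivity)] at h

theorem supNorm_deriv_scaledPsi_zero (h₁ : 0 ≤ a₁) (h₂ : 0 ≤ a₂) (hb : 0 < b) (hμ : 0 < μ) :
    supNorm (deriv (scaledPsi a₁ a₂ b μ 0)) = ENNReal.ofReal b := by
  have hd : deriv (scaledPsi a₁ a₂ b μ 0) = fun t => b * deriv (psiOne a₁ a₂) (μ⁻¹ * t) := by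
    funext t
    have : scaledPsi a₁ a₂ b μ 0 = fun t => b * μ ^ (0 + 1) * psiOne a₁ a₂ (μ⁻¹ * t) := rfl
    rw [this, deriv_const_mul_field, deriv_comp_mul_left μ⁻¹ (psiOne a₁ a₂) t, smul_eq_mul]
    field_simp
    ring
  rw [hd]
  refine le_antisymm (supNorm_le_ofReal fun t => ?_) ?_
  · rw [abs_mul, abs_of_pos hb]
    exact mul_le_of_le_one_right hb.le (abs_deriv_psiOne_le_one h₁ h₂ _)
  -- The modulus of the derivative equals `b` on a whole interval.
  · have hdense := Measure.dense_of_ae (μ := volume)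
      (ae_enorm_le_supNorm fun t => b * deriv (psiOne a₁ a₂) (μ⁻¹ * t))
    obtain ⟨t, ht, ht'⟩ := hdense.exists_mem_open
      (isOpen_Ioo (a := μ * a₁) (b := μ * (a₁ + 1)))
      (nonempty_Ioo.2 (mul_lt_mul_of_pos_left (by linarith) hμ))
    have hmem : μ⁻¹ * t ∈ Ioo a₁ (a₁ + 1) :=
      ⟨(lt_inv_mul_iff₀ hμ).2 ht'.1, (inv_mul_lt_iff₀ hμ).2 ht'.2⟩
    simp only [mem_ofPred_eq, deriv_psiOne_eq_one h₁ h₂ hmem, mul_one] at ht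
    rwa [Real.enorm_eq_ofReal hb.le] at ht

end ScaledPsi

/-! ### The derivatives of a function of the class as a tower -/

section Class

variable {n : ℕ} {x : ℝ → ℝ}

/-- The derivatives of `x` of orders `n, n - 1, …, 0`. -/
def derivTower (n : ℕ) (x : ℝ → ℝ) (k : ℕ) : ℝ → ℝ := iteratedDeriv (n - k) x

theorem isTower_derivTower (hx : ContDiff ℝ (n : ℕ∞) x) : IsTower n (derivTower n x) := by
  intro k hk t
  have hlt : n - (k + 1) < n := by omega
  have hd := (hx.differentiable_iteratedDeriv (n - (k + 1)) (Nat.cast_lt.2 hlt) t).hasDerivAt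
  rwa [← iteratedDeriv_succ, show n - (k + 1) + 1 = n - k by omega] at hd

theorem MemLInfInf.exists_bound (hx : MemLInfInf (n + 1) x) : ∃ B, ∀ t, |x t| ≤ B :=
  ⟨(supNorm x).toReal, fun t =>
    abs_le_toReal_of_enorm_le hx.memLp.2.ne (enorm_le_supNorm hx.contDiff.continuous t)⟩

theorem MemLInfInf.supNorm_ne_top (hx : MemLInfInf (n + 1) x) :
    supNorm (iteratedDeriv (n + 1) x) ≠ ⊤ := hx.memLp_iteratedDeriv.2.ne

/-- The derivative of order `r - 1` is Lipschitz with constant the norm of that of order `r`. -/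
theorem MemLInfInf.abs_sub_le (hx : MemLInfInf (n + 1) x) (s t : ℝ) :
    |iteratedDeriv n x s - iteratedDeriv n x t| ≤
      (supNorm (iteratedDeriv (n + 1) x)).toReal * |s - t| := by
  have hac : AbsolutelyContinuousOnInterval (iteratedDeriv n x) t s := hx.absolutelyContinuous t s
  rw [← hac.integral_deriv_eq_sub, ← Real.norm_eq_abs]
  refine intervalIntegral.norm_integral_le_of_norm_le_const_ae ?_
  filter_upwards [ae_enorm_le_supNorm (iteratedDeriv (n + 1) x)] with v hv _
  rw [← iteratedDeriv_succ]
  exact abs_le_toReal_of_enorm_le hx.supNorm_ne_top hv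

theorem MemLInfInf.exists_bound_derivTower (hx : MemLInfInf (n + 1) x) {k : ℕ} (hk : k ≤ n) :
    ∃ B, ∀ t, |derivTower n x k t| ≤ B := by
  have hu : IsTower n (derivTower n x) := isTower_derivTower hx.contDiff
  have hn : ∃ B, ∀ t, |derivTower n x n t| ≤ B := by
    simpa [derivTower] using hx.exists_bound
  obtain ⟨B, hB⟩ := hn
  exact hu.exists_bound ⟨_, hu.abs_zero_le ENNReal.toReal_nonneg hx.abs_sub_le hB⟩ ⟨B, hB⟩ hk

/-- A bounded function whose derivative of order `n + 1` vanishes is constant: going up in the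
tower, an antiderivative of a constant is bounded only if that constant is zero. -/
theorem IsTower.exists_const {u : ℕ → ℝ → ℝ} (hu : IsTower n u) (h0 : ∃ c, ∀ t, u 0 t = c)
    (hb : ∀ k ≤ n, ∃ B, ∀ t, |u k t| ≤ B) : ∃ c, ∀ t, u n t = c := by
  induction n with
  | zero => exact h0
  | succ n ih =>
    obtain ⟨c, hc⟩ := ih (hu.mono (Nat.le_succ n)) fun k hk => hb k (hk.trans (Nat.le_succ n))
    obtain ⟨B, hB⟩ := hb (n + 1) le_rfl
    have hlin : ∀ t, u (n + 1) t = u (n + 1) 0 + c * t := fun t => by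
      have hd : ∀ t, HasDerivAt (fun t => u (n + 1) t - c * t) 0 t := fun t => by
        refine ((hu n (Nat.lt_succ_self n) t).sub ((hasDerivAt_id t).const_mul c)).congr_deriv ?_
        rw [hc, mul_one, sub_self]
      have := is_const_of_deriv_eq_zero (fun t => (hd t).differentiableAt)
        (fun t => (hd t).deriv) t 0
      simp only [mul_zero, sub_zero] at this
      linarith
    have hc0 : c = 0 := by
      by_contra hne
      have h1 := abs_le.1 (hB ((2 * B + 1) / c))
      have h2 := abs_le.1 (hB 0)
      rw [hlin, mul_div_cancel₀ _ hne] at h1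
      linarith [h1.2, h2.1]
    exact ⟨u (n + 1) 0, fun t => by rw [hlin, hc0, zero_mul, add_zero]⟩

theorem supNorm_zero : supNorm (fun _ => 0) = 0 := eLpNorm_zero

/-- If the suprema agree at level `k`, so do the norms of the corresponding derivatives of `Ψ`
and `x`. -/
theorem MemLInfInf.supNorm_iteratedDeriv_Psi (hx : MemLInfInf (n + 1) x) {a₁ a₂ b μ : ℝ}
    (h₁ : 0 ≤ a₁) (h₂ : 0 ≤ a₂) (hb : 0 < b) (hμ : 0 < μ) {k : ℕ} (hk : k ≤ n)
    (h : b * μ ^ (k + 1) * supAbs (psi a₁ a₂ (k + 1)) = supAbs (derivTower n x k)) :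
    supNorm (iteratedDeriv (n - k) (Psi (n + 1) a₁ a₂ b (μ * (2 * a₁ + 2 * a₂ + 4)))) =
      supNorm (iteratedDeriv (n - k) x) := by
  have hlt : ((n - k : ℕ) : WithTop ℕ∞) ≤ ((n : ℕ∞) : WithTop ℕ∞) := by
    exact Nat.cast_le.2 (Nat.sub_le n k)
  have hc : Continuous (derivTower n x k) := hx.contDiff.continuous_iteratedDeriv _ hlt
  rw [Psi_eq_scaledPsi h₁ h₂, show iteratedDeriv (n - k) x = derivTower n x k from rfl,
    supNorm_eq_ofReal_supAbs hc (hx.exists_bound_derivTower hk), ← h,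
    ← supNorm_scaledPsi h₁ h₂ hb hμ]
  congr 1
  have := iteratedDeriv_scaledPsi (b := b) h₁ h₂ hμ (n - k) k
  rwa [Nat.add_sub_cancel' hk] at this

theorem MemLInfInf.supNorm_iteratedDeriv_Psi_top (hx : MemLInfInf (n + 1) x) {a₁ a₂ b μ : ℝ}
    (h₁ : 0 ≤ a₁) (h₂ : 0 ≤ a₂) (hb : 0 < b) (hμ : 0 < μ)
    (h : b = (supNorm (iteratedDeriv (n + 1) x)).toReal) :
    supNorm (iteratedDeriv (n + 1) (Psi (n + 1) a₁ a₂ b (μ * (2 * a₁ + 2 * a₂ + 4)))) =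
      supNorm (iteratedDeriv (n + 1) x) := by
  have h3 := iteratedDeriv_scaledPsi (b := b) h₁ h₂ hμ n 0
  rw [zero_add] at h3
  rw [Psi_eq_scaledPsi h₁ h₂, iteratedDeriv_succ, h3, supNorm_deriv_scaledPsi_zero h₁ h₂ hb hμ, h,
    ENNReal.ofReal_toReal hx.supNorm_ne_top]

end Class

end RodovSpline
end

theorem mainTheorem2 (r : ℕ) (hr : 1 ≤ r) (x : ℝ → ℝ) (hx : RodovSpline.MemLInfInf r x)
    (hconst : ¬ ∃ c : ℝ, c ≠ 0 ∧ ∀ t : ℝ, x t = c) :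
    (∃ a₂ lam b : ℝ, 0 ≤ a₂ ∧ 0 < lam ∧
      ∀ s : ℕ, s = 0 ∨ s + 1 = r ∨ s = r →
        RodovSpline.supNorm (iteratedDeriv s (RodovSpline.Psi r 0 a₂ b lam)) =
          RodovSpline.supNorm (iteratedDeriv s x)) ∧
    (∃ a₁ lam b : ℝ, 0 ≤ a₁ ∧ 0 < lam ∧
      ∀ s : ℕ, s = 0 ∨ s + 2 = r ∨ s = r →
        RodovSpline.supNorm (iteratedDeriv s (RodovSpline.Psi r a₁ 0 b lam)) =
          RodovSpline.supNorm (iteratedDeriv s x)) ∧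
    (∃ a₁ a₂ lam b : ℝ, 0 ≤ a₁ ∧ 0 ≤ a₂ ∧ 0 < lam ∧
      ∀ s : ℕ, s = 0 ∨ s + 2 = r ∨ s + 1 = r ∨ s = r →
        RodovSpline.supNorm (iteratedDeriv s (RodovSpline.Psi r a₁ a₂ b lam)) =
          RodovSpline.supNorm (iteratedDeriv s x)) := by
  open RodovSpline in
  obtain ⟨n, rfl⟩ : ∃ n, r = n + 1 := ⟨r - 1, by omega⟩
  have hu : IsTower n (derivTower n x) := isTower_derivTower hx.contDiff
  have hb : ∀ k ≤ n, ∃ B, ∀ t, |derivTower n x k t| ≤ B := fun k hk =>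
    hx.exists_bound_derivTower hk
  have hlip : ∀ s t, |derivTower n x 0 s - derivTower n x 0 t| ≤
      (supNorm (iteratedDeriv (n + 1) x)).toReal * |s - t| := hx.abs_sub_le
  have hunn : derivTower n x n = x := by simp [derivTower]
  set L := (supNorm (iteratedDeriv (n + 1) x)).toReal with hLdef
  have hL0 : 0 ≤ L := ENNReal.toReal_nonneg
  rcases hL0.eq_or_lt with hL | hL
  -- If the derivative of order `r` vanishes then `x = 0`, and `b = 0` will do.
  · rw [← hL] at hlip
    obtain ⟨c, hc⟩ := hu.exists_const ⟨derivTower n x 0 0, fun t => by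
      simpa [sub_eq_zero] using hlip t 0⟩ hb
    rw [hunn] at hc
    have hx0 : x = fun _ => 0 := by
      funext t
      by_contra hne
      exact hconst ⟨c, hc t ▸ hne, hc⟩
    have hPsi : ∀ a₁ a₂ : ℝ, Psi (n + 1) a₁ a₂ 0 1 = fun _ => 0 := fun a₁ a₂ => by
      funext t
      simp [Psi]
    refine ⟨⟨0, 1, 0, le_rfl, one_pos, fun s _ => ?_⟩, ⟨0, 1, 0, le_rfl, one_pos, fun s _ => ?_⟩,
      ⟨0, 0, 1, 0, le_rfl, le_rfl, one_pos, fun s _ => ?_⟩⟩ <;> rw [hPsi, hx0]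
  have h0 : 0 < supAbs (derivTower n x 0) := by
    refine (supAbs_nonneg _).lt_of_ne fun h => hL.ne' ?_
    have hz : ∀ t, iteratedDeriv n x t = 0 := fun t =>
      abs_nonpos_iff.1 (h ▸ le_supAbs (hb 0 (Nat.zero_le n)) t)
    have hz' : iteratedDeriv (n + 1) x = fun _ => 0 := by
      rw [iteratedDeriv_succ, funext hz, deriv_const']
    rw [hLdef, hz', supNorm_zero, ENNReal.toReal_zero]
  have key : ∀ {a₁ a₂ μ : ℝ}, 0 ≤ a₁ → 0 ≤ a₂ → 0 < μ → ∀ {k s : ℕ}, s + k = n →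
      L * μ ^ (k + 1) * supAbs (psi a₁ a₂ (k + 1)) = supAbs (derivTower n x k) →
      supNorm (iteratedDeriv s (Psi (n + 1) a₁ a₂ L (μ * (2 * a₁ + 2 * a₂ + 4)))) =
        supNorm (iteratedDeriv s x) := fun h₁ h₂ hμ k s hs h => by
    have := hx.supNorm_iteratedDeriv_Psi h₁ h₂ hL hμ (k := k) (by omega) h
    rwa [show n - k = s by omega] at this
  refine ⟨?_, ?_, ?_⟩
  · obtain ⟨a₂, μ, h₂, hμ, e0, en⟩ := exists_scaled_match_zero hu hL hlip hb h0
    refine ⟨a₂, μ * (2 * 0 + 2 * a₂ + 4), L, h₂, by positivity, ?_⟩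
    rintro s (rfl | hs | rfl)
    · exact key le_rfl h₂ hμ (zero_add n) en
    · exact key le_rfl h₂ hμ (by omega) e0
    · exact hx.supNorm_iteratedDeriv_Psi_top le_rfl h₂ hL hμ rfl
  · obtain ⟨a₁, μ, h₁, hμ, e1, en⟩ := exists_scaled_match_one hu hL hlip hb h0
    refine ⟨a₁, μ * (2 * a₁ + 2 * 0 + 4), L, h₁, by positivity, ?_⟩
    rintro s (rfl | hs | rfl)
    · exact key h₁ le_rfl hμ (zero_add n) en
    · exact key h₁ le_rfl hμ (by omega) (e1 (by omega))
    · exact hx.supNorm_iteratedDeriv_Psi_top h₁ le_rfl hL hμ rfl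
  · obtain ⟨a₁, a₂, μ, h₁, h₂, hμ, e0, e1, en⟩ :=
      exists_scaled_match_zero_one hu hL hlip hb h0
    refine ⟨a₁, a₂, μ * (2 * a₁ + 2 * a₂ + 4), L, h₁, h₂, by positivity, ?_⟩
    rintro s (rfl | hs | hs | rfl)
    · exact key h₁ h₂ hμ (zero_add n) en
    · exact key h₁ h₂ hμ (by omega) (e1 (by omega))
    · exact key h₁ h₂ hμ (by omega) e0
    · exact hx.supNorm_iteratedDeriv_Psi_top h₁ h₂ hL hμ rfl
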